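/- Let $R\subseteq S$ be a finite extension of complete normal Noetherian local domains (of any characteristic), with maximal ideals $\mathfrak m,\mathfrak n$, common dimension $d$, fraction fields $K\subseteq L$, and induced map $\varphi:\operatorname{Spec}S\to\operatorname{Spec}R$. Let $R^+$ be the integral closure of $R$ in an algebraic closure of $K$, fix an $R$-algebra map $S\to R^+$ (so that $R^+=S^+$), and let $B$ be a big Cohen–Macaulay $R^+$-algebra, i.e. an $R^+$-algebra on which every system of parameters of $R$ is a regular sequence; via $S\to R^+\to B$ it is also an $S$-algebra. Let $E$ be an injective hull of $R/\mathfrak m$ over $R$ and let $\omega_R\subseteq K$ be a canonical module of $R$, realized as a finitely generated submodule of $K$, with a duality isomorphism $\omega_R\cong \operatorname{Hom}_R(H^d_{\mathfrak m}(R),E)$; choose $\omega_S\subseteq L$ likewise for $S$. Let $\operatorname{Tr}:\omega_S\to\omega_R$ be a Grothendieck trace, i.e. a generator of the $S$-module $\operatorname{Hom}_R(\omega_S,\omega_R)$. For an effective $\mathbb Q$-Cartier $\mathbb Q$-divisor $\Gamma$ on $\operatorname{Spec}R$ write $n\Gamma=\operatorname{div}_R(f)$ with $n>0$ and $f\in R$,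 choose an $n$-th root $f^{1/n}\in R^+$, and put $$0^{B,\Gamma}_{H^d_{\mathfrak m}(R)}=\ker\big(H^d_{\mathfrak m}(R)\xrightarrow{\;f^{1/n}\;}H^d_{\mathfrak m}(B)\big),\qquad \tau_B(\omega_R,\Gamma)=\operatorname{Ann}_{\omega_R}0^{B,\Gamma}_{H^d_{\mathfrak m}(R)}=\{z\in\omega_R : \eta(z)=0 \text{ for all } \eta\in 0^{B,\Gamma}_{H^d_{\mathfrak m}(R)}\},$$ where $\eta(z)\in E$ is the duality pairing; this does not depend on the choices of $n$, $f$ and $f^{1/n}$. Define $\tau_B(\omega_S,-)$ in the same way over $S$. Then: (1) For every effective $\mathbb Q$-Cartier $\mathbb Q$-divisor $\Gamma\ge 0$ on $\operatorname{Spec}R$, $$\operatorname{Tr}\big(\tau_B(\omega_S,\varphi^*\Gamma)\big)=\tau_B(\omega_R,\Gamma).$$ (2) Assume moreover that $R\subseteq\omega_R$, $S\subseteq\omega_S$ and $\operatorname{Tr}(S)\subseteq R$. Let $K_R,K_S\ge 0$ be the corresponding effective canonical divisors ($\omega_R=R(K_R)$, $\omega_S=S(K_S)$), and let $\operatorname{Ram}$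 be the ramification divisor on $\operatorname{Spec}S$ given by $\operatorname{Tr}|_S\in\operatorname{Hom}_R(S,R)$, i.e. its divisor of zeros as a section of the rank one $S$-module $\operatorname{Hom}_R(S,R)$. Put $\tau_B(R,\Delta)=\tau_B(\omega_R,K_R+\Delta)$ and $\tau_B(S,\Delta')=\tau_B(\omega_S,K_S+\Delta')$. Then for every $\mathbb Q$-divisor $\Delta\ge 0$ on $\operatorname{Spec}R$ such that $K_R+\Delta$ is $\mathbb Q$-Cartier and $\varphi^*\Delta\ge\operatorname{Ram}$, $$\tau_B(R,\Delta)=\operatorname{Tr}\big(\tau_B(S,\varphi^*\Delta-\operatorname{Ram})\big).$$ -/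

import Mathlib

universe uR uS

open IsLocalRing

noncomputable section

namespace BCM

universe u v w

/-! ### Systems of parameters, big Cohen-Macaulay algebras, absolute integral closure -/

/-- `x₁, …, x_d` is a system of parameters of the local ring `R`: `d = dim R` and
`(x₁, …, x_d)` is primary to the maximal ideal. -/
def IsSystemOfParameters {R : Type u} [CommRing R] [IsLocalRing R] {d : ℕ} (x : Fin d → R) :
    Prop :=
  ringKrullDim R = d ∧ (Ideal.span (Set.range x)).radical = maximalIdeal R

/-- `B` is a (balanced) big Cohen-Macaulay `R`-algebra: every system of parameters of `R` is a
regular sequence on `B` (this includes `B / (x₁, …, x_d) B ≠ 0`). -/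
def IsBigCohenMacaulay (R : Type u) [CommRing R] [IsLocalRing R] (B : Type v) [CommRing B]
    [Algebra R B] : Prop :=
  ∀ (d : ℕ) (x : Fin d → R), IsSystemOfParameters x →
    RingTheory.Sequence.IsRegular B (List.ofFn x)

/-- `P` is (a copy of) `R⁺`, the integral closure of the domain `R` in an algebraic closure of its
fraction field. -/
def IsAbsoluteIntegralClosure (R : Type u) [CommRing R] [IsDomain R] (P : Type v) [CommRing P]
    [Algebra R P] : Prop :=
  Nonempty (P ≃ₐ[R] integralClosure R (AlgebraicClosure (FractionRing R)))

/-! ### Top local cohomology `H^d_𝔪(M)`, as the top cohomology of the Čech complex -/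

section LocalCohomology

variable {R : Type u} [CommRing R] {d : ℕ} (x : Fin d → R)

/-- `M[1 / (x₁ ⋯ x_d)]`, the last term of the Čech complex of `M` on `x₁, …, x_d`. -/
abbrev CechTop (M : Type v) [AddCommGroup M] [Module R M] : Type (max u v) :=
  LocalizedModule (Submonoid.powers (∏ i, x i)) M

/-- The image of `⨁ᵢ M[1 / (x₁ ⋯ x̂ᵢ ⋯ x_d)]` in `M[1 / (x₁ ⋯ x_d)]`: it is generated by the
elements `z` of the form `m / (x₁ ⋯ x̂ᵢ ⋯ x_d)ᵗ`. -/
def cechBoundary (M : Type v) [AddCommGroup M] [Module R M] : Submodule R (CechTop x M) :=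
  Submodule.span R {z | ∃ (i : Fin d) (t : ℕ) (m : M),
    (∏ j ∈ Finset.univ.erase i, x j) ^ t • z =
      LocalizedModule.mkLinearMap (Submonoid.powers (∏ i, x i)) M m}

/-- The top local cohomology module `H^d_𝔪(M)` of an arbitrary module `M` over a Noetherian local
ring with system of parameters `x₁, …, x_d`: the cokernel of
`⨁ᵢ M[1 / (x₁ ⋯ x̂ᵢ ⋯ x_d)] → M[1 / (x₁ ⋯ x_d)]`. -/
abbrev TopLocalCohomology (M : Type v) [AddCommGroup M] [Module R M] : Type (max u v) :=
  CechTop x M ⧸ cechBoundary x M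

/-- The map induced by an `R`-linear map on the last terms of the Čech complexes. -/
def cechTopMap {M : Type v} [AddCommGroup M] [Module R M] {N : Type w} [AddCommGroup N]
    [Module R N] (φ : M →ₗ[R] N) : CechTop x M →ₗ[R] CechTop x N :=
  IsLocalizedModule.map (Submonoid.powers (∏ i, x i))
    (LocalizedModule.mkLinearMap (Submonoid.powers (∏ i, x i)) M)
    (LocalizedModule.mkLinearMap (Submonoid.powers (∏ i, x i)) N) φ

theorem cechBoundary_le {M : Type v} [AddCommGroup M] [Module R M] {N : Type w} [AddCommGroup N]
    [Module R N] (φ : M →ₗ[R] N) :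
    cechBoundary x M ≤ (cechBoundary x N).comap (cechTopMap x φ) := by
  refine Submodule.span_le.2 ?_
  rintro z ⟨i, t, m, hz⟩
  refine Submodule.subset_span ⟨i, t, φ m, ?_⟩
  rw [← map_smul, hz]
  exact IsLocalizedModule.map_apply _ _ _ φ m

/-- The map `H^d_𝔪(M) → H^d_𝔪(N)` induced by an `R`-linear map `M → N`. -/
def topLocalCohomologyMap {M : Type v} [AddCommGroup M] [Module R M] {N : Type w} [AddCommGroup N]
    [Module R N] (φ : M →ₗ[R] N) : TopLocalCohomology x M →ₗ[R] TopLocalCohomology x N :=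
  Submodule.mapQ _ _ (cechTopMap x φ) (cechBoundary_le x φ)

end LocalCohomology

/-! ### Injective hull of the residue field, canonical ideals, Grothendieck trace -/

/-- `E` is an injective hull of the residue field of `R`: it is injective and an essential
extension of (a copy of) the residue field. -/
def IsInjectiveHullOfResidueField (R : Type u) [CommRing R] [IsLocalRing R] (E : Type u)
    [AddCommGroup E] [Module R E] : Prop :=
  Module.Injective R E ∧ ∃ ι : ResidueField R →ₗ[R] E, Function.Injective ι ∧
    ∀ N : Submodule R E, N ≠ ⊥ → N ⊓ LinearMap.range ι ≠ ⊥

/-- A canonical module of a complete local domain `R`, embedded as a fractional ideal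
`ω_R ⊆ K = Frac R`: a finitely generated submodule of `K` with a (local duality) isomorphism
`ω_R ≅ Hom_R(H^d_𝔪(R), E)`. -/
structure CanonicalIdeal {R : Type u} [CommRing R] (K : Type v) [Field K] [Algebra R K]
    {d : ℕ} (x : Fin d → R) (E : Type u) [AddCommGroup E] [Module R E] where
  /-- the fractional ideal `ω_R` -/
  carrier : Submodule R K
  /-- it is finitely generated -/
  fg : carrier.FG
  /-- the duality isomorphism -/
  duality : carrier ≃ₗ[R] (TopLocalCohomology x R →ₗ[R] E)

/-- `Tr` is a Grothendieck trace `ω_S → ω_R`: it generates `Hom_R(ω_S, ω_R)` as an `S`-module,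
where `(s · h)(z) = h (s z)`. -/
def IsGrothendieckTrace {R : Type u} [CommRing R] {S : Type v} [CommRing S]
    {M N : Type*} [AddCommGroup M] [AddCommGroup N] [Module R M] [Module S M] [Module R N]
    (Tr : M →ₗ[R] N) : Prop :=
  ∀ h : M →ₗ[R] N, ∃ s : S, ∀ z : M, h z = Tr (s • z)

/-! ### Divisors -/

/-- The prime divisors of `Spec R`: the prime ideals of height one. -/
def PrimeDivisor (R : Type u) [CommRing R] : Type u :=
  {P : PrimeSpectrum R // P.asIdeal.height = 1}

/-- The length of `N_P` over `R_P` (used only when it is finite). -/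
def lengthAt {R : Type u} [CommRing R] (N : Type v) [AddCommGroup N] [Module R N]
    (P : PrimeSpectrum R) : ℕ :=
  (Module.length (Localization.AtPrime P.asIdeal)
    (LocalizedModule P.asIdeal.primeCompl N)).toNat

/-- The cycle `∑ length(N_P) · P` of a torsion module `N`, over the prime divisors `P`. -/
def cycle {R : Type u} [CommRing R] (N : Type v) [AddCommGroup N] [Module R N] :
    PrimeDivisor R → ℚ :=
  fun P => lengthAt N P.1

/-- The principal divisor `div_R(f)` of a nonzero `f ∈ R`; its coefficient at `P` is the order
of `f` in the discrete valuation ring `R_P`. -/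
def principalDivisor {R : Type u} [CommRing R] (f : R) : PrimeDivisor R → ℚ :=
  cycle (R ⧸ Ideal.span {f})

/-- A `ℚ`-divisor `D` on the spectrum of a local domain is `ℚ`-Cartier: some positive multiple
`n D` is the divisor of an element `f / g` of the fraction field. -/
def IsQCartier {R : Type u} [CommRing R] (D : PrimeDivisor R → ℚ) : Prop :=
  ∃ n : ℕ, 0 < n ∧ ∃ f g : R, f ≠ 0 ∧ g ≠ 0 ∧
    (n : ℚ) • D = principalDivisor f - principalDivisor g

/-- The effective canonical divisor `K_R` with `ω = R(K_R)`, for a divisorial fractional ideal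
`R ⊆ ω ⊆ K`: its coefficient at `P` is the length of `ω_P / R_P`. -/
def canonicalDivisor {R : Type u} [CommRing R] {K : Type v} [Field K] [Algebra R K]
    (ω : Submodule R K) : PrimeDivisor R → ℚ :=
  cycle (ω ⧸ (1 : Submodule R K).submoduleOf ω)

open Classical in
/-- The pullback `φ^* D` along `φ : Spec S → Spec R` for a finite extension `R ⊆ S`: its coefficient
at `Q` is `e_Q · D(Q ∩ R)`, where the ramification index `e_Q` is the length of
`S_Q / (Q ∩ R) S_Q`. -/
def pullback {R : Type u} [CommRing R] (S : Type v) [CommRing S] [Algebra R S]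
    (D : PrimeDivisor R → ℚ) : PrimeDivisor S → ℚ :=
  fun Q =>
    if h : (Q.1.comap (algebraMap R S)).asIdeal.height = 1 then
      (lengthAt (S ⧸ (Q.1.comap (algebraMap R S)).asIdeal.map (algebraMap R S)) Q.1 : ℚ) *
        D ⟨Q.1.comap (algebraMap R S), h⟩
    else 0

/-- `Hom_R(S, R)`, regarded as an `S`-module by `(s · h)(t) = h (s t)`. -/
def HomDual (R : Type u) [CommRing R] (S : Type v) [CommRing S] [Algebra R S] : Type (max u v) :=
  S →ₗ[R] R

instance (R : Type u) [CommRing R] (S : Type v) [CommRing S] [Algebra R S] :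
    AddCommGroup (HomDual R S) :=
  inferInstanceAs (AddCommGroup (S →ₗ[R] R))

instance (R : Type u) [CommRing R] (S : Type v) [CommRing S] [Algebra R S] :
    Module S (HomDual R S) where
  smul s h := LinearMap.comp h (LinearMap.mulLeft R s)
  one_smul h := LinearMap.ext fun t => congrArg (DFunLike.coe (F := S →ₗ[R] R) h) (one_mul t)
  mul_smul s s' h := LinearMap.ext fun t => congrArg (DFunLike.coe (F := S →ₗ[R] R) h)
    (show s * s' * t = s' * (s * t) by ring)
  smul_zero _ := rfl
  smul_add _ _ _ := rfl
  add_smul s s' h := LinearMap.ext fun t =>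
    (congrArg (DFunLike.coe (F := S →ₗ[R] R) h) (add_mul s s' t)).trans
      (LinearMap.map_add h (s * t) (s' * t))
  zero_smul h := LinearMap.ext fun t =>
    (congrArg (DFunLike.coe (F := S →ₗ[R] R) h) (zero_mul t)).trans (LinearMap.map_zero h)

/-- An `R`-linear map `S → R` as an element of the `S`-module `Hom_R(S, R)`. -/
def HomDual.of {R : Type u} [CommRing R] {S : Type v} [CommRing S] [Algebra R S]
    (T : S →ₗ[R] R) : HomDual R S := T

/-- The ramification divisor of `T ∈ Hom_R(S, R) = ω_{S/R}`: the divisor of zeros of `T` as a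
section of the rank one `S`-module `Hom_R(S, R)`. Its coefficient at `Q` is the length of
`Hom_R(S, R)_Q / (S · T)_Q`. -/
def ramificationDivisor {R : Type u} [CommRing R] {S : Type v} [CommRing S] [Algebra R S]
    (T : S →ₗ[R] R) : PrimeDivisor S → ℚ :=
  cycle (HomDual R S ⧸ Submodule.span S {HomDual.of T})

/-! ### Test submodules and test ideals -/

section TestSubmodule

variable {R : Type u} [CommRing R] {d : ℕ} (x : Fin d → R)
  (P : Type*) [CommRing P] [Algebra R P]
  (B : Type*) [CommRing B] [Algebra R B] [Algebra P B]

/-- `0^{B, Γ}_{H^d_𝔪(R)}`, the kernel of `f^{1/n} : H^d_𝔪(R) → H^d_𝔪(B)`, where `n Γ = div_R(f)`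
with `n > 0` and `f ∈ R`, and where `g = f^{1/n}` is an `n`-th root of `f` in `P = R⁺`
(the choices of `n`, `f` and `g` do not matter). -/
def zeroSet (Γ : PrimeDivisor R → ℚ) : Set (TopLocalCohomology x R) :=
  {η | ∃ (n : ℕ) (f : R) (g : P), 0 < n ∧ f ≠ 0 ∧ (n : ℚ) • Γ = principalDivisor f ∧
    g ^ n = algebraMap R P f ∧
    topLocalCohomologyMap x
      (LinearMap.mulLeft R (algebraMap P B g) ∘ₗ Algebra.linearMap R B) η = 0}

variable {K : Type*} [Field K] [Algebra R K] {E : Type u} [AddCommGroup E] [Module R E] {x}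
  (ω : CanonicalIdeal K x E)

/-- The test submodule `τ_B(ω_R, Γ) ⊆ ω_R`, the annihilator of `0^{B, Γ}_{H^d_𝔪(R)}` under the
duality pairing `ω_R × H^d_𝔪(R) → E`. -/
def testSubmodule (Γ : PrimeDivisor R → ℚ) : Submodule R ω.carrier where
  carrier := {z | ∀ η ∈ zeroSet x P B Γ, ω.duality z η = 0}
  add_mem' {a b} ha hb η hη := by simp [ha η hη, hb η hη]
  zero_mem' η _ := by simp
  smul_mem' r a ha η hη := by simp [ha η hη]

/-- The test ideal `τ_B(R, Δ) = τ_B(ω_R, K_R + Δ)`, for `R ⊆ ω_R`. -/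
def testIdeal (Δ : PrimeDivisor R → ℚ) : Submodule R ω.carrier :=
  testSubmodule P B ω (canonicalDivisor ω.carrier + Δ)

end TestSubmodule

end BCM

end

/-!
Both formulas come down to Matlis duality for the finite extension `R ⊆ S`.

Injective hulls `E` and `F` of the residue fields are related by a map `θ : F → E` inducing
`F ≅ Hom_R(S, E)` (`exists_isDualityTrace`). Since `H^d_𝔪(S)` is the base change of `H^d_𝔪(R)`, the
dual of `ψ : H^d_𝔪(R) → H^d_𝔪(S)` is a map `Tr₀ : ω_S → ω_R`. Every `R`-linear `ω_S → ω_R` is a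
multiple of `Tr₀`, because `End_S(ω_S) = S` for a finitely generated fractional ideal over a normal
domain; so `Tr` and `Tr₀` are multiples of each other. If `N ⊆ H^d_𝔪(R)` is the preimage of a
submodule `N' ⊆ H^d_𝔪(S)`, then `H^d_𝔪(R) / N → H^d_𝔪(S) / N'` is injective, and as `E` is
injective every functional on the former extends to the latter: `Tr₀` maps `Ann N'` onto `Ann N`
(`exists_trace_eq_iff`).

For the first formula (`map_testSubmodule_eq`) take for `N` and `N'` the kernels of `f^{1/n}` into
`H^d_𝔪(B)`. The same `f^{1/n}` serves `R` and `S`, because `φ^* div_R(f) = div_S(f)` by going-down,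
and two admissible choices of the root differ by a unit of `R⁺` (`mem_zeroSet_iff`). The
compatibility of top local cohomology with the extension needs its independence of the system of
parameters, obtained by exchanging one parameter at a time (`exists_topLocalCohomology_equiv`),
and its description by the generalized fractions `[m / (x₁ ⋯ x_d)ᵗ]`, whose vanishing does not
depend on the base ring (`topFrac_eq_zero_iff`).

The second formula is the first one for `Γ = K_R + Δ`, because `φ^* K_R + Ram = K_S`
(`pullback_canonicalDivisor_add_ramificationDivisor`). This is checked at a prime `Q` of height one:
the modules `ω_S`, `ω_R` and `Hom_R(S, R)` are locally principal there, and `Ram` measures how far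
`Tr|_S` is from generating `Hom_R(S, R)` when `Tr` generates `Hom_R(ω_S, ω_R)`.
-/

open IsLocalRing

noncomputable section

namespace BCM

universe u v

/-! ### Elements of top local cohomology as generalized fractions -/

section GeneralizedFractions

variable {R : Type*} [CommRing R] {d : ℕ} (x : Fin d → R)
  {M : Type*} [AddCommGroup M] [Module R M] {N : Type*} [AddCommGroup N] [Module R N]

/-- The denominator `(x₁ ⋯ x_d)ᵗ`. -/
def denom (t : ℕ) : Submonoid.powers (∏ i, x i) :=
  ⟨(∏ i, x i) ^ t, t, rfl⟩

@[simp]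
theorem coe_denom (t : ℕ) : (denom x t : R) = (∏ i, x i) ^ t :=
  rfl

/-- The fraction `m / (x₁ ⋯ x_d)ᵗ`, as a linear function of `m`. -/
def cechFrac (t : ℕ) : M →ₗ[R] CechTop x M :=
  LocalizedModule.divBy (denom x t) ∘ₗ
    LocalizedModule.mkLinearMap (Submonoid.powers (∏ i, x i)) M

theorem cechFrac_apply (t : ℕ) (m : M) :
    cechFrac x t m = LocalizedModule.mk m (denom x t) := by
  change LocalizedModule.mk m (1 * denom x t) = _
  rw [one_mul]

/-- The class `[m / (x₁ ⋯ x_d)ᵗ]` in `H^d_𝔪(M)`, as a linear function of `m`. -/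
def topFrac (t : ℕ) : M →ₗ[R] TopLocalCohomology x M :=
  (cechBoundary x M).mkQ ∘ₗ cechFrac x t

theorem topFrac_apply (t : ℕ) (m : M) :
    topFrac x t m = (cechBoundary x M).mkQ
      (LocalizedModule.mk m (denom x t)) := by
  rw [topFrac, LinearMap.comp_apply, cechFrac_apply]

theorem exists_topFrac (η : TopLocalCohomology x M) : ∃ (t : ℕ) (m : M), topFrac x t m = η := by
  obtain ⟨z, rfl⟩ := Submodule.mkQ_surjective _ η
  induction z using LocalizedModule.induction_on with
  | h m s =>
    obtain ⟨_, t, rfl⟩ := s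
    exact ⟨t, m, topFrac_apply x t m⟩

theorem mk_pow_smul (t k : ℕ) (m : M) :
    LocalizedModule.mk ((∏ i, x i) ^ k • m)
      (denom x (t + k)) =
    LocalizedModule.mk m (denom x t) := by
  refine LocalizedModule.mk_eq.2 ⟨1, ?_⟩
  simp [Submonoid.smul_def, pow_add, mul_smul]

theorem topFrac_add (t k : ℕ) (m : M) :
    topFrac x (t + k) ((∏ i, x i) ^ k • m) = topFrac x t m := by
  rw [topFrac_apply, topFrac_apply, mk_pow_smul]

theorem mem_cechBoundary_iff (z : CechTop x M) :
    z ∈ cechBoundary x M ↔ ∃ (t : ℕ) (c : Fin d → M), z = LocalizedModule.mk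
      (∑ i, x i ^ t • c i) (denom x t) := by
  classical
  have hp (i : Fin d) : ∏ j, x j = x i * ∏ j ∈ Finset.univ.erase i, x j :=
    (Finset.mul_prod_erase _ _ (Finset.mem_univ i)).symm
  have raise (t s : ℕ) (c : Fin d → M) : LocalizedModule.mk
      (∑ i, x i ^ t • c i) (denom x t) =
      LocalizedModule.mk (∑ i, x i ^ (t + s) • (∏ j ∈ Finset.univ.erase i, x j) ^ s • c i)
        (denom x (t + s)) := by
    rw [← mk_pow_smul x t s, Finset.smul_sum]
    congr 1
    refine Finset.sum_congr rfl fun i _ => ?_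
    rw [smul_smul, smul_smul, hp i]
    congr 1
    ring
  constructor
  · intro hz
    induction hz using Submodule.span_induction with
    | mem z hz =>
      obtain ⟨i, t, m, hz⟩ := hz
      refine ⟨t, Pi.single i m, ?_⟩
      have hX : IsUnit (algebraMap R (Module.End R (CechTop x M)) ((∏ i, x i) ^ t)) :=
        IsLocalizedModule.map_units (S := Submonoid.powers (∏ i, x i))
          (LocalizedModule.mkLinearMap (Submonoid.powers (∏ i, x i)) M) (denom x t)
      refine ((Module.End.isUnit_iff _).1 hX).1 ?_
      have h1 : ∑ j, x j ^ t • (Pi.single i m : Fin d → M) j = x i ^ t • m := by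
        rw [Finset.sum_eq_single i]
        · simp
        · intro j _ hj; simp [hj]
        · simp
      rw [h1]
      change (∏ i, x i) ^ t • z = (∏ i, x i) ^ t • LocalizedModule.mk _ _
      have h3 : (∏ i, x i) ^ t • z = x i ^ t • LocalizedModule.mk m 1 := by
        rw [← LocalizedModule.mkLinearMap_apply, ← hz, smul_smul, ← mul_pow, ← hp i]
      rw [h3, LocalizedModule.smul'_mk, LocalizedModule.smul'_mk]
      exact (LocalizedModule.mk_cancel (denom x t) (x i ^ t • m)).symm
    | zero => exact ⟨0, 0, by simp⟩
    | add z w _ _ hz hw =>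
      obtain ⟨t, c, rfl⟩ := hz
      obtain ⟨s, c', rfl⟩ := hw
      refine ⟨t + s, fun i => (∏ j ∈ Finset.univ.erase i, x j) ^ s • c i +
        (∏ j ∈ Finset.univ.erase i, x j) ^ t • c' i, ?_⟩
      have h2 := raise s t c'
      simp only [add_comm s t] at h2
      rw [raise t s, h2, LocalizedModule.mk_add_mk]
      refine LocalizedModule.mk_eq.2 ⟨1, ?_⟩
      simp [Submonoid.smul_def, smul_add, Finset.sum_add_distrib, mul_smul]
    | smul r z _ hz =>
      obtain ⟨t, c, rfl⟩ := hz
      refine ⟨t, fun i => r • c i, ?_⟩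
      rw [LocalizedModule.smul'_mk, Finset.smul_sum]
      simp_rw [smul_comm r]
  · rintro ⟨t, c, rfl⟩
    have : LocalizedModule.mk
      (∑ i, x i ^ t • c i) (denom x t) =
        ∑ i, LocalizedModule.mk (x i ^ t • c i)
          (denom x t) := by
      simpa only [cechFrac_apply] using map_sum (cechFrac x t) (fun i => x i ^ t • c i) Finset.univ
    rw [this]
    refine Submodule.sum_mem _ fun i _ => Submodule.subset_span ⟨i, t, c i, ?_⟩
    rw [LocalizedModule.smul'_mk, smul_smul, ← mul_pow,
      Finset.prod_erase_mul _ _ (Finset.mem_univ i)]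
    exact LocalizedModule.mk_cancel (denom x t) (c i)

/-- `[m / (x₁ ⋯ x_d)ᵗ] = 0` means that `(x₁ ⋯ x_d)ᵏ m ∈ (x₁ᵗ⁺ᵏ, …, x_dᵗ⁺ᵏ) M` for some `k`. This
condition only involves the action of `x₁, …, x_d` on `M`, not the ring `R`. -/
theorem topFrac_eq_zero_iff (t : ℕ) (m : M) : topFrac x t m = 0 ↔
    ∃ (k : ℕ) (c : Fin d → M), (∏ i, x i) ^ k • m = ∑ i, x i ^ (t + k) • c i := by
  classical
  have hp (i : Fin d) : ∏ j, x j = x i * ∏ j ∈ Finset.univ.erase i, x j :=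
    (Finset.mul_prod_erase _ _ (Finset.mem_univ i)).symm
  rw [topFrac_apply, Submodule.mkQ_apply, Submodule.Quotient.mk_eq_zero, mem_cechBoundary_iff]
  constructor
  · rintro ⟨s, c, h⟩
    obtain ⟨⟨_, k, rfl⟩, hk⟩ := LocalizedModule.mk_eq.1 h
    refine ⟨k + s, fun i => (∏ j ∈ Finset.univ.erase i, x j) ^ (k + t) • c i, ?_⟩
    simp only [Submonoid.smul_def, coe_denom] at hk
    rw [pow_add, mul_smul, hk, Finset.smul_sum, Finset.smul_sum]
    refine Finset.sum_congr rfl fun i _ => ?_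
    rw [smul_smul, smul_smul, smul_smul, hp i]
    congr 1
    ring
  · rintro ⟨k, c, h⟩
    exact ⟨t + k, c, by rw [← h, mk_pow_smul]⟩

theorem topFrac_pow_smul (t : ℕ) (i : Fin d) (m : M) : topFrac x t (x i ^ t • m) = 0 := by
  classical
  refine (topFrac_eq_zero_iff x t _).2 ⟨0, Pi.single i m, ?_⟩
  rw [Finset.sum_eq_single i]
  · simp
  · intro j _ hj; simp [hj]
  · simp

theorem topLocalCohomologyMap_topFrac (φ : M →ₗ[R] N) (t : ℕ) (m : M) :
    topLocalCohomologyMap x φ (topFrac x t m) = topFrac x t (φ m) := by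
  rw [topFrac_apply, topFrac_apply]
  change (cechBoundary x N).mkQ (cechTopMap x φ _) = _
  congr 1
  rw [IsLocalizedModule.mk_eq_mk', IsLocalizedModule.mk_eq_mk']
  exact IsLocalizedModule.map_mk' (Submonoid.powers (∏ i, x i))
    (LocalizedModule.mkLinearMap (Submonoid.powers (∏ i, x i)) M)
    (LocalizedModule.mkLinearMap (Submonoid.powers (∏ i, x i)) N) φ m (denom x t)

theorem topFrac_succ (t : ℕ) (m : M) : topFrac x (t + 1) ((∏ i, x i) • m) = topFrac x t m := by
  simpa using topFrac_add x t 1 m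

variable {x} in
theorem topLocalCohomology_hom_ext {f g : TopLocalCohomology x M →ₗ[R] N}
    (h : ∀ t m, f (topFrac x t m) = g (topFrac x t m)) : f = g := by
  refine LinearMap.ext fun η => ?_
  obtain ⟨t, m, rfl⟩ := exists_topFrac x η
  exact h t m

theorem compatible_add {φ : ℕ → M →ₗ[R] N} (h1 : ∀ t m, φ (t + 1) ((∏ i, x i) • m) = φ t m)
    (t k : ℕ) (m : M) : φ (t + k) ((∏ i, x i) ^ k • m) = φ t m := by
  induction k with
  | zero => simp
  | succ k ih => rw [pow_succ', mul_smul, ← add_assoc, h1, ih]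

/-- The universal property of `H^d_𝔪(M) = colim_t M / (x₁ᵗ, …, x_dᵗ) M`: a family of linear maps
`φ_t` on `M`, compatible with multiplication by `x₁ ⋯ x_d` and killing `(x₁ᵗ, …, x_dᵗ) M`,
induces a linear map on `H^d_𝔪(M)`. -/
theorem exists_topLift (φ : ℕ → M →ₗ[R] N) (h1 : ∀ t m, φ (t + 1) ((∏ i, x i) • m) = φ t m)
    (h2 : ∀ t i m, φ t (x i ^ t • m) = 0) :
    ∃ f : TopLocalCohomology x M →ₗ[R] N, ∀ t m, f (topFrac x t m) = φ t m := by
  have hex (s : Submonoid.powers (∏ i, x i)) : ∃ t, denom x t = s := by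
    obtain ⟨_, t, rfl⟩ := s
    exact ⟨t, rfl⟩
  choose e he using hex
  have wd (m m' : M) (t t' k : ℕ) (h : (∏ i, x i) ^ k • (∏ i, x i) ^ t' • m =
      (∏ i, x i) ^ k • (∏ i, x i) ^ t • m') : φ t m = φ t' m' := by
    rw [← compatible_add x h1 t (k + t'), ← compatible_add x h1 t' (k + t), pow_add, mul_smul, h,
      pow_add, mul_smul]
    congr 2
    ring
  have wd' (m m' : M) (s s' : Submonoid.powers (∏ i, x i))
      (h : LocalizedModule.mk m s = LocalizedModule.mk m' s') : φ (e s) m = φ (e s') m' := by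
    obtain ⟨u, hu⟩ := LocalizedModule.mk_eq.1 h
    rw [← he u, ← he s, ← he s'] at hu
    exact wd m m' _ _ (e u) hu
  let f₀ : CechTop x M → N := fun z => LocalizedModule.liftOn z (fun p => φ (e p.2) p.1)
    fun p q hpq => wd' _ _ _ _ (LocalizedModule.mk_eq.2 hpq)
  have hf₀ (t : ℕ) (m : M) : f₀ (LocalizedModule.mk m (denom x t)) = φ t m := by
    change φ (e (denom x t)) m = φ t m
    refine wd m m _ _ 0 ?_
    have := congrArg (Subtype.val) (he (denom x t))
    simp only [coe_denom] at this
    rw [this]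
  have key (z : CechTop x M) : ∃ t m, z = LocalizedModule.mk m (denom x t) := by
    induction z using LocalizedModule.induction_on with
    | h m s => exact ⟨e s, m, by rw [he]⟩
  let f₁ : CechTop x M →ₗ[R] N :=
    { toFun := f₀
      map_add' := by
        intro z w
        obtain ⟨t, m, rfl⟩ := key z
        obtain ⟨s, n, rfl⟩ := key w
        have hts : denom x t * denom x s = denom x (t + s) :=
          Subtype.ext (pow_add _ t s).symm
        rw [LocalizedModule.mk_add_mk, hts, hf₀, hf₀, hf₀, map_add]
        congr 1
        · exact compatible_add x h1 t s m
        · rw [add_comm]; exact compatible_add x h1 s t n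
      map_smul' := by
        intro r z
        obtain ⟨t, m, rfl⟩ := key z
        rw [LocalizedModule.smul'_mk, hf₀, hf₀, map_smul]
        rfl }
  refine ⟨Submodule.liftQ _ f₁ ?_, fun t m => ?_⟩
  · intro z hz
    obtain ⟨t, c, rfl⟩ := (mem_cechBoundary_iff x z).1 hz
    refine LinearMap.mem_ker.2 ((hf₀ t _).trans ?_)
    rw [map_sum]
    exact Finset.sum_eq_zero fun i _ => h2 t i (c i)
  · rw [topFrac_apply]
    exact hf₀ t m

end GeneralizedFractions

/-! ### Exchanging one parameter -/

section Exchange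

variable {R : Type*} [CommRing R] {d : ℕ}

/-- The ideal generated by the powers `x_jᵗ` with `j ≠ i`. -/
def omitPowers (x : Fin d → R) (i : Fin d) (t : ℕ) : Ideal R :=
  Ideal.span ((fun j => x j ^ t) '' {j | j ≠ i})

theorem omitPowers_anti (x : Fin d → R) (i : Fin d) {t s : ℕ} (h : t ≤ s) :
    omitPowers x i s ≤ omitPowers x i t := by
  refine Ideal.span_le.2 ?_
  rintro _ ⟨j, hj, rfl⟩
  exact Ideal.mem_of_dvd _ (pow_dvd_pow _ h) (Ideal.subset_span ⟨j, hj, rfl⟩)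

theorem omitPowers_congr {x y : Fin d → R} {i : Fin d} (h : ∀ j, j ≠ i → x j = y j) (t : ℕ) :
    omitPowers x i t = omitPowers y i t := by
  unfold omitPowers
  congr 1
  refine Set.image_congr fun j hj => ?_
  simp only [h j hj]

/-- If a power of `a` lies in the ideal of `x₁, …, x_d`, then for every `t` there are a large `K`
and `c` with `aᴷ ≡ c x_iᵗ` modulo the powers `x_jᵗ` with `j ≠ i`. -/
theorem exists_pow_sub_mul_mem_omitPowers (x : Fin d → R) (i : Fin d) {a : R}
    (ha : a ∈ (Ideal.span (Set.range x)).radical) (t : ℕ) :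
    ∃ (K : ℕ) (c : R), t ≤ K ∧ a ^ K - c * x i ^ t ∈ omitPowers x i t := by
  have h1 : (Ideal.span (Set.range x)).radical ≤
      (omitPowers x i t ⊔ Ideal.span {x i ^ t}).radical := by
    rw [Ideal.radical_le_radical_iff, Ideal.span_le]
    rintro _ ⟨j, rfl⟩
    refine ⟨t, ?_⟩
    by_cases hj : j = i
    · subst hj
      exact Ideal.mem_sup_right (Ideal.mem_span_singleton_self _)
    · exact Ideal.mem_sup_left (Ideal.subset_span ⟨j, hj, rfl⟩)
  obtain ⟨n, hn⟩ := h1 ha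
  have hn' : a ^ (n + t) ∈ omitPowers x i t ⊔ Ideal.span {x i ^ t} := by
    rw [pow_add]; exact Ideal.mul_mem_right _ _ hn
  obtain ⟨u, hu, v, hv, huv⟩ := Submodule.mem_sup.1 hn'
  obtain ⟨c, rfl⟩ := Ideal.mem_span_singleton'.1 hv
  exact ⟨n + t, c, by omega, by rw [← huv]; simpa using hu⟩

variable {x y : Fin d → R} {i : Fin d} {M : Type*} [AddCommGroup M] [Module R M]
  {N : Type*} [AddCommGroup N] [Module R N]

open Finset in
theorem topFrac_omitPowers_smul {t K : ℕ} (htK : t ≤ K) {w : R}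
    (hw : w ∈ omitPowers x i t) (m : M) :
    topFrac x K ((w * (∏ j ∈ univ.erase i, x j) ^ (K - t)) • m) = 0 := by
  induction hw using Submodule.span_induction with
  | mem w hw =>
    obtain ⟨j, hj, rfl⟩ := hw
    rw [← mul_prod_erase (univ.erase i) x (mem_erase.2 ⟨hj, mem_univ j⟩), mul_pow, ← mul_assoc,
      ← pow_add, Nat.add_sub_cancel' htK, mul_smul]
    exact topFrac_pow_smul x K j _
  | zero => simp
  | add w w' _ _ h h' => rw [add_mul, add_smul, map_add, h, h', add_zero]
  | smul r w _ h => rw [smul_eq_mul, mul_assoc, mul_smul, map_smul, h, smul_zero]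

theorem prod_eq_mul_prod_erase (x : Fin d → R) (i : Fin d) :
    ∏ j, x j = x i * ∏ j ∈ Finset.univ.erase i, x j :=
  (Finset.mul_prod_erase _ _ (Finset.mem_univ i)).symm

theorem prod_erase_congr (hxy : ∀ j, j ≠ i → x j = y j) :
    ∏ j ∈ Finset.univ.erase i, x j = ∏ j ∈ Finset.univ.erase i, y j :=
  Finset.prod_congr rfl fun j hj => hxy j (Finset.ne_of_mem_erase hj)

/-- The class of `c pᴷ⁻ᵗ m / (y₁ ⋯ y_d)ᴷ`, with `p = ∏_{j ≠ i} x_j` and `y_iᴷ ≡ c x_iᵗ`, depends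
only on `t` and `m`. -/
theorem topFrac_exchange_unique (hxy : ∀ j, j ≠ i → x j = y j)
    (hy : y i ∈ (Ideal.span (Set.range x)).radical)
    {t K K' : ℕ} {c c' : R} (hK : t ≤ K) (hK' : t ≤ K')
    (hc : y i ^ K - c * x i ^ t ∈ omitPowers x i t)
    (hc' : y i ^ K' - c' * x i ^ t ∈ omitPowers x i t) (m : M) :
    topFrac y K ((c * (∏ j ∈ Finset.univ.erase i, x j) ^ (K - t)) • m) =
      topFrac y K' ((c' * (∏ j ∈ Finset.univ.erase i, x j) ^ (K' - t)) • m) := by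
  obtain ⟨L, b, hL, hb⟩ := exists_pow_sub_mul_mem_omitPowers x i hy t
  -- both sides are rewritten with the common denominator `(y₁ ⋯ y_d)ᴷ⁺ᴷ'⁺ᴸ`
  have step (K' K : ℕ) (c : R) (hK : t ≤ K) :
      topFrac y K ((c * (∏ j ∈ Finset.univ.erase i, x j) ^ (K - t)) • m) =
      topFrac y (K + K' + L) (((y i ^ (K' + L) * c) *
        (∏ j ∈ Finset.univ.erase i, x j) ^ (K + K' + L - t)) • m) := by
    have e : (∏ j, y j) ^ (K' + L) * (c * (∏ j ∈ Finset.univ.erase i, x j) ^ (K - t)) =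
        (y i ^ (K' + L) * c) * (∏ j ∈ Finset.univ.erase i, x j) ^ (K + (K' + L) - t) := by
      rw [prod_eq_mul_prod_erase y i, ← prod_erase_congr hxy,
        show K + (K' + L) - t = (K' + L) + (K - t) by omega]
      ring
    rw [add_assoc, ← topFrac_add y K (K' + L), smul_smul, e]
  rw [step K' K c hK, step K K' c' hK', add_comm K' K, ← sub_eq_zero, ← map_sub, ← sub_smul,
    ← sub_mul]
  have hmem : y i ^ (K' + L) * c - y i ^ (K + L) * c' ∈ omitPowers x i t := by
    have e : y i ^ (K' + L) * c - y i ^ (K + L) * c' =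
        (y i ^ L - b * x i ^ t) * (y i ^ K' * c - y i ^ K * c') +
        b * (y i ^ K * (y i ^ K' - c' * x i ^ t) - y i ^ K' * (y i ^ K - c * x i ^ t)) := by
      ring
    rw [e]
    exact add_mem (Ideal.mul_mem_right _ _ hb) (Ideal.mul_mem_left _ _
      (sub_mem (Ideal.mul_mem_left _ _ hc') (Ideal.mul_mem_left _ _ hc)))
  rw [omitPowers_congr hxy] at hmem
  rw [prod_erase_congr hxy]
  exact topFrac_omitPowers_smul (by omega) hmem m

/-- If `x` and `y` differ only in the `i`-th entry and generate ideals with the same radical, there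
is a map `H^d(x; M) → H^d(y; M)` given by `[m / (x₁ ⋯ x_d)ᵗ] ↦ [c pᴷ⁻ᵗ m / (y₁ ⋯ y_d)ᴷ]`. -/
theorem exists_exchange (hxy : ∀ j, j ≠ i → x j = y j)
    (hy : y i ∈ (Ideal.span (Set.range x)).radical) (M : Type*) [AddCommGroup M] [Module R M] :
    ∃ f : TopLocalCohomology x M →ₗ[R] TopLocalCohomology y M,
      ∀ (t K : ℕ) (c : R) (m : M), t ≤ K → y i ^ K - c * x i ^ t ∈ omitPowers x i t →
        f (topFrac x t m) =
          topFrac y K ((c * (∏ j ∈ Finset.univ.erase i, x j) ^ (K - t)) • m) := by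
  choose K c hK hc using exists_pow_sub_mul_mem_omitPowers x i hy
  have key := exists_topLift x (N := TopLocalCohomology y M)
    (fun t => topFrac y (K t) ∘ₗ
      LinearMap.lsmul R M (c t * (∏ j ∈ Finset.univ.erase i, x j) ^ (K t - t))) ?_ ?_
  · obtain ⟨f, hf⟩ := key
    refine ⟨f, fun t K' c' m hK' hc' => ?_⟩
    rw [hf]
    exact topFrac_exchange_unique hxy hy (hK t) hK' (hc t) hc' m
  · intro t m
    simp only [LinearMap.comp_apply, LinearMap.lsmul_apply]
    have h1 := hK (t + 1)
    have h2 : y i ^ K (t + 1) - (c (t + 1) * x i) * x i ^ t ∈ omitPowers x i t := by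
      have := omitPowers_anti x i (Nat.le_succ t) (hc (t + 1))
      rwa [pow_succ', ← mul_assoc] at this
    rw [← topFrac_exchange_unique hxy hy (by omega) (hK t) h2 (hc t) m, smul_smul,
      prod_eq_mul_prod_erase x i, show K (t + 1) - t = K (t + 1) - (t + 1) + 1 by omega]
    congr 2
    ring
  · intro t j m
    simp only [LinearMap.comp_apply, LinearMap.lsmul_apply, smul_smul]
    by_cases hj : j = i
    · subst hj
      have e : c t * (∏ k ∈ Finset.univ.erase j, x k) ^ (K t - t) * x j ^ t =
          (∏ k ∈ Finset.univ.erase j, x k) ^ (K t - t) * y j ^ K t -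
          (y j ^ K t - c t * x j ^ t) * (∏ k ∈ Finset.univ.erase j, x k) ^ (K t - t) := by
        ring
      have h3 := hc t
      rw [omitPowers_congr hxy] at h3
      rw [e, sub_smul, map_sub, mul_comm, mul_smul, topFrac_pow_smul, prod_erase_congr hxy,
        topFrac_omitPowers_smul (hK t) h3, sub_zero]
    · rw [mul_assoc, mul_smul, map_smul, mul_comm, prod_erase_congr hxy,
        topFrac_omitPowers_smul (hK t), smul_zero]
      exact Ideal.subset_span ⟨j, hj, by simp only [hxy j hj]⟩

/-- The composite of two exchange maps is the exchange map from `x` to itself. -/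
theorem exchange_comp_exchange (hxy : ∀ j, j ≠ i → x j = y j)
    (hy : y i ∈ (Ideal.span (Set.range x)).radical)
    (hx : x i ∈ (Ideal.span (Set.range y)).radical)
    {f : TopLocalCohomology x M →ₗ[R] TopLocalCohomology y M}
    (hf : ∀ (t K : ℕ) (c : R) (m : M), t ≤ K → y i ^ K - c * x i ^ t ∈ omitPowers x i t →
      f (topFrac x t m) = topFrac y K ((c * (∏ j ∈ Finset.univ.erase i, x j) ^ (K - t)) • m))
    {g : TopLocalCohomology y M →ₗ[R] TopLocalCohomology x M}
    (hg : ∀ (t K : ℕ) (c : R) (m : M), t ≤ K → x i ^ K - c * y i ^ t ∈ omitPowers y i t →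
      g (topFrac y t m) = topFrac x K ((c * (∏ j ∈ Finset.univ.erase i, y j) ^ (K - t)) • m)) :
    g ∘ₗ f = LinearMap.id := by
  refine topLocalCohomology_hom_ext fun t m => ?_
  obtain ⟨K, c, hK, hc⟩ := exists_pow_sub_mul_mem_omitPowers x i hy t
  obtain ⟨L, b, hL, hb⟩ := exists_pow_sub_mul_mem_omitPowers y i hx K
  rw [LinearMap.comp_apply, hf t K c m hK hc, hg K L b _ hL hb, smul_smul,
    ← prod_erase_congr hxy, LinearMap.id_apply]
  have hself : x i ∈ (Ideal.span (Set.range x)).radical :=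
    Ideal.le_radical (Ideal.subset_span ⟨i, rfl⟩)
  have h1 : x i ^ L - (b * c) * x i ^ t ∈ omitPowers x i t := by
    rw [← omitPowers_congr hxy] at hb
    have e : x i ^ L - (b * c) * x i ^ t =
      (x i ^ L - b * y i ^ K) + b * (y i ^ K - c * x i ^ t) := by ring
    rw [e]
    exact add_mem (omitPowers_anti x i hK hb) (Ideal.mul_mem_left _ _ hc)
  have h2 : x i ^ t - 1 * x i ^ t ∈ omitPowers x i t := by simp
  have := topFrac_exchange_unique (fun _ _ => rfl) hself (hK.trans hL) le_rfl h1 h2 m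
  rw [Nat.sub_self, pow_zero, one_mul, one_smul] at this
  rw [← this, show L - t = (L - K) + (K - t) by omega]
  congr 2
  ring

/-- Exchanging one parameter changes neither `H^d(x; M)` nor the map induced by `φ : M → N`. -/
theorem exists_exchange_equiv (hxy : ∀ j, j ≠ i → x j = y j)
    (hy : y i ∈ (Ideal.span (Set.range x)).radical)
    (hx : x i ∈ (Ideal.span (Set.range y)).radical) (φ : M →ₗ[R] N) :
    ∃ (e₁ : TopLocalCohomology x M ≃ₗ[R] TopLocalCohomology y M)
      (e₂ : TopLocalCohomology x N ≃ₗ[R] TopLocalCohomology y N),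
      ∀ η, topLocalCohomologyMap y φ (e₁ η) = e₂ (topLocalCohomologyMap x φ η) := by
  have hyx : ∀ j, j ≠ i → y j = x j := fun j hj => (hxy j hj).symm
  obtain ⟨f, hf⟩ := exists_exchange hxy hy M
  obtain ⟨g, hg⟩ := exists_exchange hyx hx M
  obtain ⟨f', hf'⟩ := exists_exchange hxy hy N
  obtain ⟨g', hg'⟩ := exists_exchange hyx hx N
  refine ⟨LinearEquiv.ofLinearMap f g (exchange_comp_exchange hyx hx hy hg hf)
      (exchange_comp_exchange hxy hy hx hf hg),
    LinearEquiv.ofLinearMap f' g' (exchange_comp_exchange hyx hx hy hg' hf')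
      (exchange_comp_exchange hxy hy hx hf' hg'),
    fun η => ?_⟩
  obtain ⟨t, m, rfl⟩ := exists_topFrac x η
  obtain ⟨K, c, hK, hc⟩ := exists_pow_sub_mul_mem_omitPowers x i hy t
  change topLocalCohomologyMap y φ (f _) = f' _
  rw [hf t K c m hK hc,
    topLocalCohomologyMap_topFrac, topLocalCohomologyMap_topFrac, hf' t K c _ hK hc, map_smul]

end Exchange

/-! ### Systems of parameters -/

section SystemsOfParameters

variable {R : Type*} [CommRing R] [IsLocalRing R]

theorem IsSystemOfParameters.mem {d : ℕ} {x : Fin d → R} (hx : IsSystemOfParameters x) (i : Fin d) :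
    x i ∈ maximalIdeal R :=
  hx.2 ▸ Ideal.le_radical (Ideal.subset_span ⟨i, rfl⟩)

variable [IsNoetherianRing R]

/-- `d - 1` of the parameters generate an ideal over which the maximal ideal is not minimal. -/
theorem maximalIdeal_notMem_minimalPrimes_omit {d : ℕ} {x : Fin d → R}
    (hx : ringKrullDim R = d) (i : Fin d) :
    maximalIdeal R ∉ (Ideal.span (x '' {j | j ≠ i})).minimalPrimes := by
  classical
  intro h
  have h1 : (x '' {j | j ≠ i}) = (((Finset.univ.erase i).image x : Finset R) : Set R) := by
    ext; simp
  rw [h1] at h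
  have h2 := Ideal.height_le_card_of_mem_minimalPrimes_span_finset h
  have h3 : ((Finset.univ.erase i).image x).card < d :=
    Finset.card_image_le.trans_lt (by
      rw [Finset.card_erase_of_mem (Finset.mem_univ i), Finset.card_fin]
      have := i.pos
      omega)
  have h4 := IsLocalRing.maximalIdeal_height_eq_ringKrullDim (R := R)
  rw [hx] at h4
  have h5 : (maximalIdeal R).height = (d : ℕ∞) := by exact_mod_cast h4
  rw [h5] at h2
  exact absurd (by exact_mod_cast h2) (not_le.2 h3)

/-- An element of `𝔪` outside the minimal primes of the other parameters can replace `x_i`: a prime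
strictly between a minimal prime of the others and `𝔪` could be moved to contain `x_i`. -/
theorem IsSystemOfParameters.update {d : ℕ} {x : Fin d → R} (hx : IsSystemOfParameters x)
    (i : Fin d) {z : R} (hz : z ∈ maximalIdeal R)
    (hz' : ∀ p ∈ (Ideal.span (x '' {j | j ≠ i})).minimalPrimes, z ∉ p) :
    IsSystemOfParameters (Function.update x i z) := by
  refine ⟨hx.1, ?_⟩
  refine le_antisymm ?_ ?_
  · rw [← (IsLocalRing.maximalIdeal.isMaximal R).isPrime.radical, Ideal.radical_le_radical_iff,
      (IsLocalRing.maximalIdeal.isMaximal R).isPrime.radical, Ideal.span_le]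
    rintro _ ⟨j, rfl⟩
    by_cases hj : j = i
    · subst hj; simpa using hz
    · simpa [hj] using hx.mem j
  · rw [Ideal.radical_eq_sInf]
    refine le_sInf ?_
    rintro q ⟨hq, hqp⟩
    have h1 : Ideal.span (x '' {j | j ≠ i}) ≤ q := by
      refine le_trans (Ideal.span_le.2 ?_) hq
      rintro _ ⟨j, hj, rfl⟩
      exact Ideal.subset_span ⟨j, Function.update_of_ne hj z x⟩
    obtain ⟨p, hp, hpq⟩ := Ideal.exists_minimalPrimes_le h1
    have hzq : z ∈ q := hq (Ideal.subset_span ⟨i, by simp⟩)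
    have hpq' : p < q := lt_of_le_of_ne hpq fun h => hz' p hp (h ▸ hzq)
    by_contra hne
    have hqm : q < maximalIdeal R :=
      lt_of_le_of_ne (IsLocalRing.le_maximalIdeal hqp.ne_top) fun h => hne h.ge
    have hpp : p.IsPrime := hp.1.1
    obtain ⟨q', hxq', hpq'', hq'm⟩ := PrimeSpectrum.exist_mem_one_of_mem_maximal_ideal
      (p₀ := ⟨p, hpp⟩) (p₁ := ⟨q, hqp⟩) hpq' hqm (hx.mem i)
    refine hq'm.not_ge ?_
    rw [← hx.2]
    refine (Ideal.IsPrime.radical_le_iff q'.isPrime).2 (Ideal.span_le.2 ?_)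
    rintro _ ⟨j, rfl⟩
    by_cases hj : j = i
    · exact hj ▸ hxq'
    · exact hpq''.le (hp.1.2 (Ideal.subset_span ⟨j, hj, rfl⟩))

/-- Two systems of parameters have a common replacement for their `i`-th entries. -/
theorem exists_common_update {d : ℕ} {x y : Fin d → R} (hx : IsSystemOfParameters x)
    (hy : IsSystemOfParameters y) (i : Fin d) :
    ∃ z, IsSystemOfParameters (Function.update x i z) ∧
      IsSystemOfParameters (Function.update y i z) := by
  have hfin := (Ideal.finite_minimalPrimes_of_isNoetherianRing R
    (Ideal.span (x '' {j | j ≠ i}))).union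
    (Ideal.finite_minimalPrimes_of_isNoetherianRing R (Ideal.span (y '' {j | j ≠ i})))
  have hnot : ¬ ((maximalIdeal R : Set R) ⊆
      ⋃ p ∈ (Ideal.span (x '' {j | j ≠ i})).minimalPrimes ∪
        (Ideal.span (y '' {j | j ≠ i})).minimalPrimes, (p : Set R)) := by
    rw [Ideal.subset_iUnion_iff_mem_of_isMaximal_of_finite hfin ⊥ ⊥]
    · rintro (h | h)
      · exact maximalIdeal_notMem_minimalPrimes_omit hx.1 i h
      · exact maximalIdeal_notMem_minimalPrimes_omit hy.1 i h
    · rintro p (h | h) _ _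
      · exact h.1.1
      · exact h.1.1
    · exact bot_ne_top
    · exact bot_ne_top
  obtain ⟨z, hz, hz'⟩ := Set.not_subset.1 hnot
  simp only [Set.mem_iUnion, not_exists] at hz'
  exact ⟨z, hx.update i hz fun p hp => hz' p (Or.inl hp),
    hy.update i hz fun p hp => hz' p (Or.inr hp)⟩

variable {M : Type*} [AddCommGroup M] [Module R M] {N : Type*} [AddCommGroup N] [Module R N]

/-- Top local cohomology, with the map induced by `φ`, does not depend on the system of
parameters: two systems of parameters are connected by exchanging one parameter at a time. -/
theorem exists_topLocalCohomology_equiv {d : ℕ} {x y : Fin d → R} (hx : IsSystemOfParameters x)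
    (hy : IsSystemOfParameters y) (φ : M →ₗ[R] N) :
    ∃ (e₁ : TopLocalCohomology x M ≃ₗ[R] TopLocalCohomology y M)
      (e₂ : TopLocalCohomology x N ≃ₗ[R] TopLocalCohomology y N),
      ∀ η, topLocalCohomologyMap y φ (e₁ η) = e₂ (topLocalCohomologyMap x φ η) := by
  have trans {x y z : Fin d → R}
      (h : ∃ (e₁ : TopLocalCohomology x M ≃ₗ[R] TopLocalCohomology y M)
        (e₂ : TopLocalCohomology x N ≃ₗ[R] TopLocalCohomology y N),
        ∀ η, topLocalCohomologyMap y φ (e₁ η) = e₂ (topLocalCohomologyMap x φ η))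
      (h' : ∃ (e₁ : TopLocalCohomology y M ≃ₗ[R] TopLocalCohomology z M)
        (e₂ : TopLocalCohomology y N ≃ₗ[R] TopLocalCohomology z N),
        ∀ η, topLocalCohomologyMap z φ (e₁ η) = e₂ (topLocalCohomologyMap y φ η)) :
      ∃ (e₁ : TopLocalCohomology x M ≃ₗ[R] TopLocalCohomology z M)
        (e₂ : TopLocalCohomology x N ≃ₗ[R] TopLocalCohomology z N),
        ∀ η, topLocalCohomologyMap z φ (e₁ η) = e₂ (topLocalCohomologyMap x φ η) := by
    obtain ⟨e₁, e₂, h⟩ := h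
    obtain ⟨f₁, f₂, h'⟩ := h'
    exact ⟨e₁.trans f₁, e₂.trans f₂, fun η => by simp [h, h']⟩
  have step {x y : Fin d → R} (hx : IsSystemOfParameters x) (hy : IsSystemOfParameters y)
      (i : Fin d) (hxy : ∀ j, j ≠ i → x j = y j) :=
    exists_exchange_equiv hxy (hx.2 ▸ hy.mem i) (hy.2 ▸ hx.mem i) φ
  suffices ∀ (k : ℕ) (x y : Fin d → R), IsSystemOfParameters x → IsSystemOfParameters y →
      (∀ j : Fin d, k ≤ j → x j = y j) →
      ∃ (e₁ : TopLocalCohomology x M ≃ₗ[R] TopLocalCohomology y M)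
        (e₂ : TopLocalCohomology x N ≃ₗ[R] TopLocalCohomology y N),
        ∀ η, topLocalCohomologyMap y φ (e₁ η) = e₂ (topLocalCohomologyMap x φ η) from
    this d x y hx hy fun j hj => absurd j.2 (not_lt.2 hj)
  intro k
  induction k with
  | zero =>
    intro x y _ _ hxy
    obtain rfl : x = y := funext fun j => hxy j (Nat.zero_le _)
    exact ⟨LinearEquiv.refl _ _, LinearEquiv.refl _ _, fun η => rfl⟩
  | succ k ih =>
    intro x y hx hy hxy
    by_cases hk : k < d
    · obtain ⟨z, hzx, hzy⟩ := exists_common_update hx hy ⟨k, hk⟩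
      refine trans (step hx hzx ⟨k, hk⟩ fun j hj => by simp [hj]) (trans (ih _ _ hzx hzy ?_)
        (step hzy hy ⟨k, hk⟩ fun j hj => by simp [hj]))
      intro j hj
      by_cases hjk : j = ⟨k, hk⟩
      · subst hjk; simp
      · have : (j : ℕ) ≠ k := fun h => hjk (Fin.ext h)
        simp only [Function.update_of_ne hjk]
        exact hxy j (by omega)
    · exact ih x y hx hy fun j hj => absurd j.2 (by omega)

end SystemsOfParameters

/-! ### Finite local extensions -/

section Extension

theorem height_comap_le {R : Type*} [CommRing R] [IsNoetherianRing R] [IsIntegrallyClosed R]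
    {S : Type*} [CommRing S] [IsDomain S] [IsNoetherianRing S] [Algebra R S] [Module.Finite R S]
    (hRS : Function.Injective (algebraMap R S)) (Q : Ideal S) [Q.IsPrime] :
    (Q.comap (algebraMap R S)).height ≤ Q.height := by
  have : FaithfulSMul R S := (faithfulSMul_iff_algebraMap_injective R S).2 hRS
  have : Q.LiesOver (Q.comap (algebraMap R S)) := ⟨rfl⟩
  rw [Ideal.height_eq_height_add_of_liesOver_of_hasGoingDown (Q.comap (algebraMap R S)) Q]
  exact le_self_add

theorem comap_maximalIdeal_eq {R : Type*} [CommRing R] [IsLocalRing R]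
    {S : Type*} [CommRing S] [IsLocalRing S] [Algebra R S] [Module.Finite R S] :
    (maximalIdeal S).comap (algebraMap R S) = maximalIdeal R :=
  IsLocalRing.eq_maximalIdeal (Ideal.isMaximal_comap_of_isIntegral_of_isMaximal _)

/-- A system of parameters of `R` is one of a finite local extension. -/
theorem IsSystemOfParameters.map {R : Type*} [CommRing R] [IsLocalRing R]
    [IsNoetherianRing R] [IsIntegrallyClosed R]
    {S : Type*} [CommRing S] [IsDomain S] [IsLocalRing S] [IsNoetherianRing S]
    [Algebra R S] [Module.Finite R S] (hRS : Function.Injective (algebraMap R S)) {d : ℕ}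
    {x : Fin d → R} (hx : IsSystemOfParameters x) :
    IsSystemOfParameters (fun i => algebraMap R S (x i)) := by
  classical
  have hrad : (Ideal.span (Set.range fun i => algebraMap R S (x i))).radical = maximalIdeal S := by
    refine le_antisymm ?_ ?_
    · rw [← (IsLocalRing.maximalIdeal.isMaximal S).isPrime.radical, Ideal.radical_le_radical_iff,
        (IsLocalRing.maximalIdeal.isMaximal S).isPrime.radical, Ideal.span_le]
      rintro _ ⟨j, rfl⟩
      have := hx.mem j
      rwa [← comap_maximalIdeal_eq (S := S)] at this
    · rw [Ideal.radical_eq_sInf]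
      refine le_sInf ?_
      rintro q ⟨hq, hqp⟩
      have h1 : maximalIdeal R ≤ q.comap (algebraMap R S) := by
        rw [← hx.2]
        refine (Ideal.IsPrime.radical_le_iff (hqp.comap _)).2 (Ideal.span_le.2 ?_)
        rintro _ ⟨j, rfl⟩
        exact hq (Ideal.subset_span ⟨j, rfl⟩)
      have h2 : (q.comap (algebraMap R S)).IsMaximal :=
        (IsLocalRing.maximalIdeal.isMaximal R).eq_of_le (hqp.comap _).ne_top h1 ▸
          IsLocalRing.maximalIdeal.isMaximal R
      have := Ideal.isMaximal_of_isIntegral_of_isMaximal_comap q h2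
      exact (IsLocalRing.eq_maximalIdeal this).ge
  refine ⟨le_antisymm ?_ ?_, hrad⟩
  · rw [← IsLocalRing.maximalIdeal_height_eq_ringKrullDim]
    have h1 : maximalIdeal S ∈ (Ideal.span (((Finset.univ.image fun i =>
        algebraMap R S (x i)) : Finset S) : Set S)).minimalPrimes := by
      rw [Finset.coe_image, Finset.coe_univ, Set.image_univ, ← Ideal.radical_minimalPrimes, hrad,
        Ideal.minimalPrimes_eq_subsingleton_self]
      rfl
    have h2 := Ideal.height_le_card_of_mem_minimalPrimes_span_finset h1
    have h3 : (Finset.univ.image fun i => algebraMap R S (x i)).card ≤ d :=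
      Finset.card_image_le.trans (by simp)
    exact_mod_cast h2.trans (by exact_mod_cast h3)
  · rw [← hx.1, ← IsLocalRing.maximalIdeal_height_eq_ringKrullDim (R := S),
      ← IsLocalRing.maximalIdeal_height_eq_ringKrullDim (R := R),
      ← comap_maximalIdeal_eq (R := R) (S := S)]
    exact_mod_cast height_comap_le hRS (maximalIdeal S)

end Extension

/-! ### Duality for a finite extension -/

section Duality

/-- `Hom_R(S, E)`, regarded as an `S`-module by `(s · h)(t) = h (s t)`. -/
def Coind (R : Type*) [CommRing R] (S : Type*) [CommRing S] [Algebra R S]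
    (E : Type*) [AddCommGroup E] [Module R E] : Type _ :=
  S →ₗ[R] E

namespace Coind

variable (R : Type*) [CommRing R] (S : Type*) [CommRing S] [Algebra R S]
    (E : Type*) [AddCommGroup E] [Module R E]

instance : AddCommGroup (Coind R S E) :=
  inferInstanceAs (AddCommGroup (S →ₗ[R] E))

variable {R S E} in
/-- A linear map `S → E` as an element of `Hom_R(S, E)`. -/
def of (f : S →ₗ[R] E) : Coind R S E := f

variable {R S E} in
/-- The linear map `S → E` underlying an element of `Hom_R(S, E)`. -/
def hom (f : Coind R S E) : S →ₗ[R] E := f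

variable {R S E} in
theorem ext {f g : Coind R S E} (h : ∀ s, f.hom s = g.hom s) : f = g :=
  LinearMap.ext h

instance : Module S (Coind R S E) where
  smul s f := of (f.hom ∘ₗ LinearMap.mulLeft R s)
  one_smul f := ext fun t => congrArg f.hom (one_mul t)
  mul_smul s s' f := ext fun t => congrArg f.hom (show s * s' * t = s' * (s * t) by ring)
  smul_zero _ := rfl
  smul_add _ _ _ := rfl
  add_smul s s' f := ext fun t => (congrArg f.hom (add_mul s s' t)).trans (map_add f.hom _ _)
  zero_smul f := ext fun t => (congrArg f.hom (zero_mul t)).trans (map_zero f.hom)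

variable {R S E}

theorem hom_smul (s : S) (f : Coind R S E) (t : S) : (s • f).hom t = f.hom (s * t) :=
  rfl

end Coind

section InjectiveHull

variable {R : Type*} [CommRing R] [IsLocalRing R]
  {E : Type*} [AddCommGroup E] [Module R E] {ι : ResidueField R →ₗ[R] E}

/-- An element of an essential extension of the residue field killed by `𝔪` lies in the residue
field. -/
theorem mem_range_of_maximalIdeal_smul_eq_zero
    (hι : ∀ N : Submodule R E, N ≠ ⊥ → N ⊓ LinearMap.range ι ≠ ⊥) {e : E}
    (he : ∀ r ∈ maximalIdeal R, r • e = 0) : e ∈ LinearMap.range ι := by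
  by_cases h0 : e = 0
  · subst h0; exact zero_mem _
  · obtain ⟨a, ⟨ha, ha'⟩, hane⟩ := (Submodule.ne_bot_iff _).1
      (hι (Submodule.span R {e}) (by simpa using h0))
    obtain ⟨r, rfl⟩ := Submodule.mem_span_singleton.1 ha
    have hr : IsUnit r := by
      by_contra hr
      exact hane (he r ((mem_maximalIdeal r).2 hr))
    exact (Submodule.smul_mem_iff_of_isUnit _ hr).1 ha'

/-- A nonzero submodule of an essential extension of the residue field contains the residue
field. -/
theorem range_le_of_ne_bot (hι : ∀ N : Submodule R E, N ≠ ⊥ → N ⊓ LinearMap.range ι ≠ ⊥)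
    {N : Submodule R E} (hN : N ≠ ⊥) : LinearMap.range ι ≤ N := by
  obtain ⟨a, ⟨ha, b, rfl⟩, hane⟩ := (Submodule.ne_bot_iff _).1 (hι N hN)
  have hb : b ≠ 0 := by rintro rfl; simp at hane
  rintro _ ⟨c, rfl⟩
  obtain ⟨r, hr⟩ := residue_surjective (c / b)
  have : c = r • b := by
    rw [Algebra.smul_def, ResidueField.algebraMap_eq, hr, div_mul_cancel₀ _ hb]
  rw [this, map_smul]
  exact N.smul_mem r ha

/-- Every element of an essential extension of the residue field is killed by a power of `𝔪`,
by Krull's intersection theorem. -/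
theorem exists_pow_smul_eq_zero [IsNoetherianRing R]
    (hι : ∀ N : Submodule R E, N ≠ ⊥ → N ⊓ LinearMap.range ι ≠ ⊥) (hinj : Function.Injective ι)
    (e : E) : ∃ n : ℕ, ∀ r ∈ maximalIdeal R ^ n, r • e = 0 := by
  by_contra! hcon
  let N := Submodule.span R {e}
  have hfin : Module.Finite R N := Module.Finite.of_fg (Submodule.fg_span_singleton e)
  have hkrull := Ideal.iInf_pow_smul_eq_bot_of_isLocalRing (M := N) (maximalIdeal R)
    (Ideal.IsPrime.ne_top inferInstance)
  have hle (n : ℕ) : LinearMap.range ι ≤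
      ((maximalIdeal R ^ n) • (⊤ : Submodule R N)).map N.subtype := by
    refine range_le_of_ne_bot hι ?_
    obtain ⟨r, hr, hre⟩ := hcon n
    refine (Submodule.ne_bot_iff _).2 ⟨r • e, ?_, hre⟩
    exact ⟨r • ⟨e, Submodule.mem_span_singleton_self e⟩,
      Submodule.smul_mem_smul hr Submodule.mem_top, rfl⟩
  have hmem : ι 1 ∈ N := by
    obtain ⟨a, _, ha⟩ := hle 0 ⟨1, rfl⟩
    exact ha ▸ a.2
  have h0 : (⟨ι 1, hmem⟩ : N) ∈ (⨅ i : ℕ, (maximalIdeal R ^ i) • ⊤ : Submodule R N) := by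
    refine (Submodule.mem_iInf _).2 fun n => ?_
    obtain ⟨a, ha, hae⟩ := hle n ⟨1, rfl⟩
    have : a = ⟨ι 1, hmem⟩ := Subtype.ext hae
    exact this ▸ ha
  rw [hkrull, Submodule.mem_bot] at h0
  have : ι 1 = ι 0 := by simpa using congrArg Subtype.val h0
  exact one_ne_zero (hinj this)

end InjectiveHull

/-- The functionals on a finite field extension `l` of `k` are the multiples of any nonzero one: they
form an `l`-vector space of dimension one. -/
theorem exists_eq_mul_of_ne_zero {k l : Type*} [Field k] [Field l] [Algebra k l]
    [FiniteDimensional k l] {f : l →ₗ[k] k} (hf : f ≠ 0) (g : l →ₗ[k] k) :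
    ∃ c : l, ∀ a, g a = f (c * a) := by
  let Φ : l →ₗ[k] (l →ₗ[k] k) := (LinearMap.mul k l).compr₂ f
  have hinj : Function.Injective Φ := by
    rw [injective_iff_map_eq_zero]
    intro c hc
    by_contra hne
    refine hf (LinearMap.ext fun a => ?_)
    have := LinearMap.congr_fun hc (c⁻¹ * a)
    simpa [Φ, mul_inv_cancel_left₀ hne] using this
  have hsurj := (LinearMap.injective_iff_surjective_of_finrank_eq_finrank
    (Subspace.dual_finrank_eq (K := k) (V := l)).symm).1 hinj
  obtain ⟨c, hc⟩ := hsurj g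
  exact ⟨c, fun a => by rw [← hc]; rfl⟩

/-- `θ : F → E` induces an isomorphism `F ≅ Hom_R(S, E)`, `a ↦ (s ↦ θ (s a))`. -/
def IsDualityTrace {R : Type*} [CommRing R] (S : Type*) [CommRing S] [Algebra R S]
    {E : Type*} [AddCommGroup E] [Module R E] {F : Type*} [AddCommGroup F] [Module R F] [Module S F]
    (θ : F →ₗ[R] E) : Prop :=
  (∀ a : F, (∀ s : S, θ (s • a) = 0) → a = 0) ∧
    ∀ f : S →ₗ[R] E, ∃ a : F, ∀ s : S, θ (s • a) = f s

section

variable {R : Type*} [CommRing R] [IsLocalRing R]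
  {S : Type*} [CommRing S] [IsLocalRing S] [Algebra R S] [Module.Finite R S]
  {E : Type*} [AddCommGroup E] [Module R E]

/-- A nonzero homomorphism `u : S → E` into an injective hull has a nonzero multiple killed by the
maximal ideal of `S`. -/
theorem exists_smul_ne_zero_of_coind [IsNoetherianRing R] {ι : ResidueField R →ₗ[R] E}
    (hι : ∀ N : Submodule R E, N ≠ ⊥ → N ⊓ LinearMap.range ι ≠ ⊥) (hinj : Function.Injective ι)
    {u : Coind R S E} (hu : u ≠ 0) :
    ∃ r : S, r • u ≠ 0 ∧ ∀ s ∈ maximalIdeal S, s • r • u = 0 := by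
  classical
  -- a power of `𝔪` kills the values of `u` on generators of `S`, hence `u`
  obtain ⟨G, hG⟩ := Module.Finite.fg_top (R := R) (M := S)
  choose n hn using fun g : S => exists_pow_smul_eq_zero hι hinj (u.hom g)
  have h1 : ∀ r ∈ maximalIdeal R ^ (G.sup n), ∀ t : S, r • u.hom t = 0 := by
    intro r hr t
    have ht : t ∈ Submodule.span R (G : Set S) := hG ▸ Submodule.mem_top
    induction ht using Submodule.span_induction with
    | mem g hg => exact hn g r (Ideal.pow_le_pow_right (Finset.le_sup hg) hr)
    | zero => simp
    | add a b _ _ ha hb => rw [map_add, smul_add, ha, hb, add_zero]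
    | smul c a _ ha => rw [map_smul, smul_comm, ha, smul_zero]
  -- hence so does a power of the maximal ideal of `S`
  have hS : IsNoetherianRing S := IsNoetherianRing.of_finite R S
  have h2 : maximalIdeal S ≤ ((maximalIdeal R ^ (G.sup n)).map (algebraMap R S)).radical := by
    rw [Ideal.radical_eq_sInf]
    refine le_sInf ?_
    rintro q ⟨hq, hqp⟩
    have h3 : maximalIdeal R ≤ q.comap (algebraMap R S) :=
      Ideal.IsPrime.le_of_pow_le (hP := hqp.comap _) (Ideal.map_le_iff_le_comap.1 hq)
    have h4 : (q.comap (algebraMap R S)).IsMaximal :=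
      (IsLocalRing.maximalIdeal.isMaximal R).eq_of_le (hqp.comap _).ne_top h3 ▸
        IsLocalRing.maximalIdeal.isMaximal R
    exact (IsLocalRing.eq_maximalIdeal (Ideal.isMaximal_of_isIntegral_of_isMaximal_comap q h4)).ge
  obtain ⟨m, hm⟩ := Ideal.exists_pow_le_of_le_radical_of_fg h2 (IsNoetherian.noetherian _)
  have h5 : ∃ k : ℕ, ∀ s ∈ maximalIdeal S ^ k, s • u = 0 := by
    refine ⟨m, fun s hs => ?_⟩
    have hs' := hm hs
    rw [Ideal.map] at hs'
    clear hs
    induction hs' using Submodule.span_induction with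
    | mem s hs' =>
      obtain ⟨r, hr, rfl⟩ := hs'
      refine Coind.ext fun t => ?_
      rw [Coind.hom_smul, ← Algebra.smul_def, map_smul]
      exact h1 r hr t
    | zero => exact zero_smul _ _
    | add a b _ _ ha hb => rw [add_smul, ha, hb, add_zero]
    | smul c a _ ha => rw [smul_eq_mul, mul_smul, ha, smul_zero]
  have hk0 : Nat.find h5 ≠ 0 := by
    intro h0
    have := Nat.find_spec h5
    rw [h0] at this
    exact hu (by simpa using this 1 (by simp))
  have h6 := Nat.find_min h5 (Nat.sub_one_lt hk0)
  push Not at h6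
  obtain ⟨r, hr, hru⟩ := h6
  refine ⟨r, hru, fun s hs => ?_⟩
  rw [smul_smul]
  refine Nat.find_spec h5 _ ?_
  have h7 := Ideal.mul_mem_mul hs hr
  rwa [← pow_succ', Nat.sub_add_cancel (Nat.one_le_iff_ne_zero.2 hk0)] at h7

/-- A homomorphism `v : S → E` killed by the maximal ideal of `S` comes from a functional on the
residue field of `S`. -/
theorem exists_dual_of_maximalIdeal_smul_eq_zero [IsLocalHom (algebraMap R S)]
    {ι : ResidueField R →ₗ[R] E}
    (hι : ∀ N : Submodule R E, N ≠ ⊥ → N ⊓ LinearMap.range ι ≠ ⊥) (hinj : Function.Injective ι)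
    {v : Coind R S E} (hv : ∀ s ∈ maximalIdeal S, s • v = 0) :
    ∃ μ : ResidueField S →ₗ[ResidueField R] ResidueField R,
      ∀ s, ι (μ (residue S s)) = v.hom s := by
  have h0 (s : S) (hs : s ∈ maximalIdeal S) : v.hom s = 0 := by
    have := congrArg (fun w : Coind R S E => w.hom 1) (hv s hs)
    rw [Coind.hom_smul, mul_one] at this
    exact this
  have h1 (t : ResidueField S) : ∃ b, ∀ s, residue S s = t → ι b = v.hom s := by
    obtain ⟨s, rfl⟩ := residue_surjective t
    obtain ⟨b, hb⟩ := mem_range_of_maximalIdeal_smul_eq_zero hι (e := v.hom s) (by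
      intro r hr
      have hr' : algebraMap R S r ∈ maximalIdeal S := by
        rwa [← comap_maximalIdeal_eq (S := S)] at hr
      rw [← map_smul, Algebra.smul_def]
      exact h0 _ (Ideal.mul_mem_right _ _ hr'))
    refine ⟨b, fun s' hs' => ?_⟩
    rw [hb, ← sub_eq_zero, ← map_sub]
    exact h0 _ ((Ideal.Quotient.eq).1 hs'.symm)
  choose μ hμ using h1
  refine ⟨⟨⟨μ, fun a b => ?_⟩, fun c a => ?_⟩, fun s => hμ _ s rfl⟩
  · obtain ⟨a, rfl⟩ := residue_surjective a
    obtain ⟨b, rfl⟩ := residue_surjective b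
    apply hinj
    rw [hμ _ (a + b) (map_add _ _ _), map_add, map_add, hμ _ a rfl, hμ _ b rfl]
  · obtain ⟨c, rfl⟩ := residue_surjective c
    obtain ⟨a, rfl⟩ := residue_surjective a
    apply hinj
    have e : residue R c • μ (residue S a) = c • μ (residue S a) := rfl
    rw [RingHom.id_apply, e, map_smul, hμ _ a rfl, hμ _ (c • a), map_smul]
    rw [Algebra.smul_def, map_mul, Algebra.smul_def]
    rfl

end

/-- Duality for a finite local extension: `F ≅ Hom_R(S, E)` for injective hulls `E`, `F` of the
residue fields of `R` and `S`. The map `θ` extends a nonzero functional between the residue fields.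
The induced map `F → Hom_R(S, E)` is a split injection, and it is onto because a complement
would meet the socle of `Hom_R(S, E)`, which is one-dimensional over the residue field of `S`. -/
theorem exists_isDualityTrace {R : Type u} [CommRing R] [IsLocalRing R] [IsNoetherianRing R]
    {S : Type v} [CommRing S] [IsLocalRing S] [Algebra R S] [Module.Finite R S]
    {E : Type u} [AddCommGroup E] [Module R E] (hE : IsInjectiveHullOfResidueField R E)
    {F : Type v} [AddCommGroup F] [Module R F] [Module S F] [IsScalarTower R S F]
    (hF : IsInjectiveHullOfResidueField S F) :
    ∃ θ : F →ₗ[R] E, IsDualityTrace S θ := by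
  have hloc : IsLocalHom (algebraMap R S) :=
    ((IsLocalRing.local_hom_TFAE (algebraMap R S)).out 0 4).2 comap_maximalIdeal_eq
  obtain ⟨hEinj, ιE, hιE, hessE⟩ := hE
  obtain ⟨hFinj, ιF, hιF, hessF⟩ := hF
  obtain ⟨f, hf⟩ : ∃ f : ResidueField S →ₗ[ResidueField R] ResidueField R, f ≠ 0 := by
    by_contra! h
    exact one_ne_zero ((Module.forall_dual_apply_eq_zero_iff (ResidueField R)
      (1 : ResidueField S)).1 fun f => by rw [h f]; rfl)
  obtain ⟨θ, hθ⟩ := Module.Injective.extension_property R E (ResidueField S) F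
    (ιF.restrictScalars R) hιF (ιE ∘ₗ f.restrictScalars R)
  have hθ' (c : ResidueField S) : θ (ιF c) = ιE (f c) := LinearMap.congr_fun hθ c
  let j : F →ₗ[S] Coind R S E :=
    { toFun := fun a => Coind.of (θ ∘ₗ (LinearMap.toSpanSingleton S F a).restrictScalars R)
      map_add' := fun a b => Coind.ext fun s => by
        change θ (s • (a + b)) = θ (s • a) + θ (s • b)
        rw [smul_add, map_add]
      map_smul' := fun r a => Coind.ext fun s => by
        change θ (s • r • a) = θ ((r * s) • a)
        rw [smul_smul, mul_comm] }
  have hj (a : F) (s : S) : (j a).hom s = θ (s • a) := rfl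
  have hinj : ∀ a : F, (∀ s : S, θ (s • a) = 0) → a = 0 := by
    intro a ha
    by_contra hne
    have hle := range_le_of_ne_bot hessF (N := LinearMap.ker j)
      ((Submodule.ne_bot_iff _).2 ⟨a, Coind.ext ha, hne⟩)
    refine hf (LinearMap.ext fun c => hιE ?_)
    have h1 := congrArg (fun w : Coind R S E => w.hom 1) (LinearMap.mem_ker.1 (hle ⟨c, rfl⟩))
    have h2 : θ ((1 : S) • ιF c) = 0 := h1
    rw [one_smul, hθ'] at h2
    rw [h2]; simp
  refine ⟨θ, hinj, fun g => ?_⟩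
  have hjinj : Function.Injective j := by
    rw [injective_iff_map_eq_zero]
    exact fun a ha => hinj a fun s => congrArg (fun w : Coind R S E => w.hom s) ha
  obtain ⟨p, hp⟩ := Module.Injective.extension_property S F F (Coind R S E) j hjinj LinearMap.id
  have hp' (a : F) : p (j a) = a := LinearMap.congr_fun hp a
  suffices h : Coind.of g = j (p (Coind.of g)) by
    exact ⟨p (Coind.of g), fun s => (congrArg (fun w : Coind R S E => w.hom s) h).symm⟩
  by_contra hne
  obtain ⟨r, hr, hru⟩ := exists_smul_ne_zero_of_coind hessE hιE (sub_ne_zero.2 hne)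
  obtain ⟨μ, hμ⟩ := exists_dual_of_maximalIdeal_smul_eq_zero hessE hιE hru
  obtain ⟨c, hc⟩ := exists_eq_mul_of_ne_zero hf μ
  have hv : r • (Coind.of g - j (p (Coind.of g))) = j (ιF c) := by
    refine Coind.ext fun s => ?_
    rw [← hμ, hc, hj, ← map_smul, hθ', Algebra.smul_def, mul_comm]
    rfl
  have hpv := congrArg p hv
  rw [map_smul, map_sub, hp', sub_self, smul_zero, hp'] at hpv
  rw [← hpv, map_zero] at hv
  exact hr hv

end Duality

/-! ### Traces and annihilators -/

section Trace

variable {R : Type u} [CommRing R] {S : Type*} [CommRing S] [Algebra R S]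
  {E : Type u} [AddCommGroup E] [Module R E]
  {F : Type*} [AddCommGroup F] [Module R F] [Module S F]
  {θ : F →ₗ[R] E}

theorem IsDualityTrace.exists_lift (hθ : IsDualityTrace S θ) {M : Type*} [AddCommGroup M]
    [Module R M] [Module S M] [IsScalarTower R S M] (g : M →ₗ[R] E) :
    ∃ φ : M →ₗ[S] F, ∀ m, θ (φ m) = g m := by
  choose φ hφ using fun m : M =>
    hθ.2 (g ∘ₗ (LinearMap.toSpanSingleton S M m).restrictScalars R)
  have hφ' (m : M) (s : S) : θ (s • φ m) = g (s • m) := hφ m s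
  refine ⟨⟨⟨φ, fun m n => ?_⟩, fun r m => ?_⟩, fun m => by simpa using hφ' m 1⟩
  · refine sub_eq_zero.1 (hθ.1 _ fun s => ?_)
    rw [smul_sub, smul_add, map_sub, map_add, hφ', hφ', hφ', smul_add, map_add, sub_self]
  · refine sub_eq_zero.1 (hθ.1 _ fun s => ?_)
    rw [RingHom.id_apply, smul_sub, smul_smul, map_sub, hφ', hφ', smul_smul, sub_self]

variable {A : Type*} [AddCommGroup A] [Module R A]
  {A' : Type*} [AddCommGroup A'] [Module R A'] [Module S A'] [IsScalarTower R S A']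
  {W : Type*} [AddCommGroup W] [Module R W]
  {W' : Type*} [AddCommGroup W'] [Module R W'] [Module S W'] [IsScalarTower R S W']

/-- The image of an annihilator under a generator `Tr` of `Hom_R(W', W)`, where `W` and `W'` are
dual to `A` and `A'` and `ψ : A → A'` makes `A'` the base change of `A` (`hext`). Up to a multiple
in `S`, the map `Tr` is the dual `Tr₀` of `ψ`; and `Tr₀` maps the annihilator of `N'` onto that of
`N = ψ⁻¹ N'`, because `E` is injective and `A / N → A' / N'` is injective. -/
theorem exists_trace_eq_iff [Module.Injective R E] [IsScalarTower R S F]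
    (hθ : IsDualityTrace S θ) (ψ : A →ₗ[R] A')
    (hext : ∀ β : S →ₗ[R] A →ₗ[R] E, ∃ φ : A' →ₗ[S] F, ∀ s a, θ (s • φ (ψ a)) = β s a)
    (hspan : Submodule.span S (Set.range ψ) = ⊤)
    (D : W ≃ₗ[R] (A →ₗ[R] E)) (D' : W' ≃ₗ[S] (A' →ₗ[S] F))
    (hEnd : ∀ h : W' →ₗ[S] W', ∃ s : S, ∀ z, h z = s • z)
    {Tr : W' →ₗ[R] W} (hTr : IsGrothendieckTrace (S := S) Tr)
    (N : Submodule R A) (N' : Submodule S A') (hN : ∀ a, a ∈ N ↔ ψ a ∈ N') (w : W) :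
    (∃ z : W', (∀ a ∈ N', D' z a = 0) ∧ Tr z = w) ↔ ∀ a ∈ N, D w a = 0 := by
  let Tr₀ : W' →ₗ[R] W :=
    { toFun := fun z => D.symm (θ ∘ₗ (D' z).restrictScalars R ∘ₗ ψ)
      map_add' := fun z z' => by
        rw [← map_add]
        congr 1
        ext a
        simp
      map_smul' := fun r z => by
        rw [RingHom.id_apply, ← map_smul]
        congr 1
        ext a
        rw [← algebraMap_smul S r z, map_smul]
        simp }
  have hTr₀ (z : W') (a : A) : D (Tr₀ z) a = θ (D' z (ψ a)) := by
    change D (D.symm _) a = _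
    rw [D.apply_symm_apply]
    rfl
  constructor
  · rintro ⟨z, hz, rfl⟩
    -- `a ↦ D (Tr (s z)) a` extends to `A'`, which yields an endomorphism of `W'`
    have hβ (z : W') : ∃ φ : A' →ₗ[S] F, ∀ s a, θ (s • φ (ψ a)) = D (Tr (s • z)) a :=
      hext
        { toFun := fun s => D (Tr (s • z))
          map_add' := fun s t => by rw [add_smul, map_add, map_add]
          map_smul' := fun r s => by rw [RingHom.id_apply, smul_assoc, map_smul, map_smul] }
    choose φ hφ using hβ
    have huniq {φ φ' : A' →ₗ[S] F} (h : ∀ (s : S) a, θ (s • φ (ψ a)) = θ (s • φ' (ψ a))) :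
        φ = φ' := by
      refine LinearMap.ext_on_range (f := φ) (g := φ') hspan fun a => ?_
      refine sub_eq_zero.1 (hθ.1 _ fun s => ?_)
      rw [smul_sub, map_sub, h, sub_self]
    obtain ⟨s, hs⟩ := hEnd
      { toFun := fun z => D'.symm (φ z)
        map_add' := fun z z' => by
          rw [← map_add]
          congr 1
          refine huniq fun s a => ?_
          rw [hφ, LinearMap.add_apply, smul_add, smul_add, map_add, map_add, map_add, hφ, hφ,
            LinearMap.add_apply]
        map_smul' := fun r z => by
          rw [RingHom.id_apply, ← map_smul]
          congr 1
          refine huniq fun s a => ?_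
          rw [hφ, LinearMap.smul_apply, smul_smul, smul_smul, hφ] }
    have hs' : φ z = s • D' z := by
      rw [← map_smul, ← hs]
      exact (D'.apply_symm_apply _).symm
    intro a ha
    have := hφ z 1 a
    rw [one_smul, one_smul] at this
    rw [← this, hs', LinearMap.smul_apply, hz _ ((hN a).1 ha), smul_zero, map_zero]
  · intro hw
    obtain ⟨s, hs⟩ := hTr Tr₀
    have hle : N ≤ (N'.restrictScalars R).comap ψ := fun a ha => (hN a).1 ha
    have hinj : Function.Injective (N.mapQ (N'.restrictScalars R) ψ hle) := by
      rw [injective_iff_map_eq_zero]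
      intro b hb
      obtain ⟨a, rfl⟩ := N.mkQ_surjective b
      exact (Submodule.Quotient.mk_eq_zero _).2
        ((hN a).2 ((Submodule.Quotient.mk_eq_zero (N'.restrictScalars R)).1 hb))
    obtain ⟨h, hh⟩ := Module.Injective.extension_property R E _ _ _ hinj
      (N.liftQ (D w) hw)
    obtain ⟨φ, hφ⟩ := hθ.exists_lift (h ∘ₗ (N'.restrictScalars R).mkQ)
    have hφN (a : A') (ha : a ∈ N') : φ a = 0 := by
      refine hθ.1 _ fun s => ?_
      rw [← map_smul, hφ]
      have : (N'.restrictScalars R).mkQ (s • a) = 0 :=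
        (Submodule.Quotient.mk_eq_zero _).2 (N'.smul_mem s ha)
      rw [LinearMap.comp_apply, this, map_zero]
    have hφψ (a : A) : θ (φ (ψ a)) = D w a := by
      rw [hφ]
      exact LinearMap.congr_fun hh (N.mkQ a)
    refine ⟨s • D'.symm φ, fun a ha => ?_, ?_⟩
    · rw [map_smul, D'.apply_symm_apply, LinearMap.smul_apply, hφN a ha, smul_zero]
    · rw [← hs]
      apply D.injective
      ext a
      rw [hTr₀, D'.apply_symm_apply, hφψ]

end Trace

/-! ### Orders along prime divisors -/

section Order

variable {R : Type*} [CommRing R] [IsDomain R] [IsNoetherianRing R] [IsIntegrallyClosed R]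

instance PrimeDivisor.isDiscreteValuationRing (Q : PrimeDivisor R) :
    IsDiscreteValuationRing (Localization.AtPrime Q.1.asIdeal) := by
  have hh : (maximalIdeal (Localization.AtPrime Q.1.asIdeal)).height = 1 := by
    have h1 := IsLocalRing.maximalIdeal_height_eq_ringKrullDim
      (R := Localization.AtPrime Q.1.asIdeal)
    rw [IsLocalization.AtPrime.ringKrullDim_eq_height Q.1.asIdeal, Q.2] at h1
    exact_mod_cast h1
  have hne : maximalIdeal (Localization.AtPrime Q.1.asIdeal) ≠ ⊥ := Ideal.ne_bot_of_height_eq_one hh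
  have hic : IsIntegrallyClosed (Localization.AtPrime Q.1.asIdeal) :=
    isIntegrallyClosed_of_isLocalization _ Q.1.asIdeal.primeCompl
      Q.1.asIdeal.primeCompl_le_nonZeroDivisors
  have hpir : IsPrincipalIdealRing (Localization.AtPrime Q.1.asIdeal) := by
    have htfae : (IsIntegrallyClosed (Localization.AtPrime Q.1.asIdeal) ∧
        ∀ p : Ideal (Localization.AtPrime Q.1.asIdeal), p ≠ ⊥ → p.IsPrime → p = maximalIdeal _) ↔
        IsPrincipalIdealRing (Localization.AtPrime Q.1.asIdeal) :=
      (tfae_of_isNoetherianRing_of_isLocalRing_of_isDomain _).out 3 0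
    refine htfae.1 ⟨hic, fun p hp hpp => ?_⟩
    by_contra hpne
    have hlt := lt_of_le_of_ne (IsLocalRing.le_maximalIdeal hpp.ne_top) hpne
    have hfin : p.FiniteHeight := inferInstance
    have := Ideal.height_strict_mono_of_isPrime_of_isPrime hlt
    rw [hh, Order.lt_one_iff, Ideal.height_eq_zero_iff_eq_bot] at this
    exact hp this
  exact { not_a_field' := hne }

/-- The order of `a` along the prime divisor `Q`, with `ord Q 0 = ⊤`. -/
def ord (Q : PrimeDivisor R) (a : R) : ℕ∞ :=
  IsDiscreteValuationRing.addVal (Localization.AtPrime Q.1.asIdeal) (algebraMap R _ a)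

variable (Q : PrimeDivisor R)

theorem ord_mul (a b : R) : ord Q (a * b) = ord Q a + ord Q b := by
  rw [ord, map_mul, IsDiscreteValuationRing.addVal_mul]; rfl

theorem ord_pow (a : R) (n : ℕ) : ord Q (a ^ n) = n • ord Q a := by
  rw [ord, map_pow, IsDiscreteValuationRing.addVal_pow]; rfl

theorem ord_one : ord Q 1 = 0 := by
  rw [ord, map_one, IsDiscreteValuationRing.addVal_one]

theorem algebraMap_atPrime_injective {R : Type*} [CommRing R] [IsDomain R] (Q : PrimeDivisor R) :
    Function.Injective (algebraMap R (Localization.AtPrime Q.1.asIdeal)) :=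
  IsLocalization.injective _ Q.1.asIdeal.primeCompl_le_nonZeroDivisors

theorem ord_eq_top_iff {a : R} : ord Q a = ⊤ ↔ a = 0 := by
  rw [ord, IsDiscreteValuationRing.addVal_eq_top_iff,
    map_eq_zero_iff _ (algebraMap_atPrime_injective Q)]

theorem ord_ne_top {a : R} (ha : a ≠ 0) : ord Q a ≠ ⊤ :=
  mt (ord_eq_top_iff Q).1 ha

theorem ord_eq_zero_iff {a : R} : ord Q a = 0 ↔ a ∉ Q.1.asIdeal := by
  rw [ord, IsDiscreteValuationRing.addVal_eq_zero_iff,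
    IsLocalization.AtPrime.isUnit_to_map_iff _ Q.1.asIdeal]
  rfl

/-- Comparing orders along `Q` means divisibility up to an element outside `Q`. -/
theorem ord_le_ord_iff {a b : R} :
    ord Q a ≤ ord Q b ↔ ∃ σ ∉ Q.1.asIdeal, ∃ c, σ * b = a * c := by
  rw [ord, ord, IsDiscreteValuationRing.addVal_le_iff_dvd]
  constructor
  · rintro ⟨w, hw⟩
    obtain ⟨c, σ, rfl⟩ := IsLocalization.exists_mk'_eq Q.1.asIdeal.primeCompl w
    refine ⟨σ, σ.2, c, algebraMap_atPrime_injective Q ?_⟩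
    rw [map_mul, map_mul, hw, mul_left_comm, IsLocalization.mk'_spec']
  · rintro ⟨σ, hσ, c, h⟩
    have hu := IsLocalization.map_units (Localization.AtPrime Q.1.asIdeal)
      (⟨σ, hσ⟩ : Q.1.asIdeal.primeCompl)
    refine hu.dvd_mul_left.1 ?_
    rw [← map_mul]
    exact ⟨algebraMap R _ c, by rw [← map_mul]; exact congrArg _ h⟩

theorem exists_ord_eq_one : ∃ π : R, ord Q π = 1 := by
  obtain ⟨w, hw⟩ := IsDiscreteValuationRing.exists_irreducible
    (Localization.AtPrime Q.1.asIdeal)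
  obtain ⟨a, s, rfl⟩ := IsLocalization.exists_mk'_eq Q.1.asIdeal.primeCompl w
  refine ⟨a, ?_⟩
  have h1 := IsDiscreteValuationRing.addVal_uniformizer hw
  rw [ord, ← IsLocalization.mk'_spec _ a s, IsDiscreteValuationRing.addVal_mul, h1,
    (IsDiscreteValuationRing.addVal_eq_zero_iff).2 (IsLocalization.map_units _ s), add_zero]

theorem one_le_ord_iff {a : R} : 1 ≤ ord Q a ↔ a ∈ Q.1.asIdeal := by
  rw [Order.one_le_iff_ne_zero, ne_eq, ord_eq_zero_iff, not_not]

/-- A cyclic module over the valuation ring of `Q` with annihilator the elements of order `≥ k` has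
length `k`. -/
theorem lengthAt_eq_of_cyclic {M : Type*} [AddCommGroup M] [Module R M] {m₀ : M} {k : ℕ}
    (hgen : ∀ m : M, ∃ σ ∉ Q.1.asIdeal, ∃ r : R, σ • m = r • m₀)
    (hann : ∀ a : R, (∃ σ ∉ Q.1.asIdeal, (σ * a) • m₀ = 0) ↔ (k : ℕ∞) ≤ ord Q a) :
    lengthAt M Q.1 = k := by
  let A := Localization.AtPrime Q.1.asIdeal
  let MQ := LocalizedModule Q.1.asIdeal.primeCompl M
  let f : A →ₗ[A] MQ := LinearMap.toSpanSingleton A MQ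
    (LocalizedModule.mkLinearMap Q.1.asIdeal.primeCompl M m₀)
  have hf (a : R) (s : Q.1.asIdeal.primeCompl) :
      f (IsLocalization.mk' A a s) = LocalizedModule.mk (a • m₀) s := by
    have h := LocalizedModule.mk_smul_mk a m₀ s (1 : Q.1.asIdeal.primeCompl)
    rw [mul_one, Localization.mk_eq_mk'] at h
    exact h
  have hsurj : Function.Surjective f := by
    intro z
    induction z using LocalizedModule.induction_on with
    | h m s =>
      obtain ⟨σ, hσ, r, hr⟩ := hgen m
      refine ⟨IsLocalization.mk' A r (s * ⟨σ, hσ⟩), ?_⟩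
      rw [hf, ← hr]
      exact LocalizedModule.mk_cancel_common_right s ⟨σ, hσ⟩ m
  have hker : LinearMap.ker f = maximalIdeal A ^ k := by
    ext w
    obtain ⟨a, s, rfl⟩ := IsLocalization.exists_mk'_eq Q.1.asIdeal.primeCompl w
    obtain ⟨ϖ, hϖ⟩ := IsDiscreteValuationRing.exists_irreducible A
    have h1 : IsDiscreteValuationRing.addVal A (IsLocalization.mk' A a s) = ord Q a := by
      rw [ord, ← IsLocalization.mk'_spec A a s, IsDiscreteValuationRing.addVal_mul,
        (IsDiscreteValuationRing.addVal_eq_zero_iff).2 (IsLocalization.map_units A s), add_zero]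
    rw [LinearMap.mem_ker, hf, hϖ.maximalIdeal_eq, Ideal.span_singleton_pow,
      Ideal.mem_span_singleton, ← IsDiscreteValuationRing.addVal_le_iff_dvd,
      Irreducible.addVal_pow hϖ, h1, ← hann, ← LocalizedModule.zero_mk s,
      LocalizedModule.mk_eq]
    constructor
    · rintro ⟨u, hu⟩
      refine ⟨u * s, (u * s).2, ?_⟩
      rw [smul_zero, smul_zero] at hu
      rw [mul_smul, mul_smul]
      exact hu
    · rintro ⟨σ, hσ, h⟩
      refine ⟨⟨σ, hσ⟩, ?_⟩
      rw [smul_zero, smul_zero, smul_comm]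
      rw [mul_smul] at h
      exact (congrArg (s • ·) h).trans (smul_zero s)
  have e : (A ⧸ maximalIdeal A ^ k) ≃ₗ[A] MQ :=
    (Submodule.quotEquivOfEq _ _ hker.symm).trans (f.quotKerEquivOfSurjective hsurj)
  change (Module.length A MQ).toNat = k
  rw [← e.length_eq, IsDiscreteValuationRing.length_quotient_pow_maximalIdeal, ENat.toNat_natCast]

/-- The length at `Q` of `D / N`, for a torsion-free module `D` of rank one and a submodule `N` that
agrees with `⟨T⟩` at `Q`. The elements of `D` are fractions `(p / q) T`, and `k` is the largest
value of `ord q - ord p`. -/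
theorem lengthAt_quotient_eq {D : Type*} [AddCommGroup D] [Module R D]
    (htf : ∀ (s : R) (h : D), s • h = 0 → s = 0 ∨ h = 0) {T : D} (hT : T ≠ 0)
    {N : Submodule R D} (hTN : T ∈ N)
    (hN : ∀ z ∈ N, ∃ σ ∉ Q.1.asIdeal, ∃ b : R, σ • z = b • T) {h₀ : D} {p₀ q₀ : R} {k : ℕ}
    (hq₀ : q₀ ≠ 0) (h₀T : q₀ • h₀ = p₀ • T) (hk : ord Q q₀ = ord Q p₀ + k)
    (hmax : ∀ h : D, ∃ q p : R, q ≠ 0 ∧ q • h = p • T ∧ ord Q q ≤ ord Q p + k) :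
    lengthAt (D ⧸ N) Q.1 = k := by
  have cancel {a b : R} {h h' : D} (ha : a ≠ 0) (e : a • h = a • h') : h = h' :=
    sub_eq_zero.1 ((htf a _ (by rw [smul_sub, e, sub_self])).resolve_left ha)
  have cancelT {a b : R} (e : a • T = b • T) : a = b :=
    sub_eq_zero.1 ((htf _ T (by rw [sub_smul, e, sub_self])).resolve_right hT)
  have hp₀ : p₀ ≠ 0 := by
    rintro rfl
    rw [(ord_eq_top_iff Q).2 rfl, top_add] at hk
    exact hq₀ ((ord_eq_top_iff Q).1 hk)
  refine lengthAt_eq_of_cyclic Q (m₀ := N.mkQ h₀) ?_ ?_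
  · intro m
    obtain ⟨h, rfl⟩ := N.mkQ_surjective m
    obtain ⟨q, p, hq, hqp, hle⟩ := hmax h
    have h1 : ord Q (p₀ * q) ≤ ord Q (p * q₀) := by
      rw [ord_mul, ord_mul, hk, add_left_comm]
      gcongr
    obtain ⟨σ, hσ, α, hα⟩ := (ord_le_ord_iff Q).1 h1
    refine ⟨σ, hσ, α, ?_⟩
    rw [← map_smul, ← map_smul]
    congr 1
    refine cancel (b := 0) (mul_ne_zero hp₀ hq) ?_
    calc (p₀ * q) • σ • h = (p₀ * σ) • q • h := by simp only [smul_smul]; congr 1; ring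
      _ = (σ * p) • p₀ • T := by rw [hqp]; simp only [smul_smul]; congr 1; ring
      _ = (σ * (p * q₀)) • h₀ := by rw [← h₀T, smul_smul]; congr 1; ring
      _ = (p₀ * q) • α • h₀ := by rw [hα, smul_smul]
  · intro a
    constructor
    · rintro ⟨σ, hσ, h⟩
      rw [← map_smul, Submodule.mkQ_apply, Submodule.Quotient.mk_eq_zero] at h
      obtain ⟨σ', hσ', β, hβ⟩ := hN _ h
      have h1 : σ' * σ * (a * p₀) = q₀ * β := by
        refine cancelT ?_
        calc (σ' * σ * (a * p₀)) • T = (σ' * σ * a) • q₀ • h₀ := by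
              rw [h₀T, smul_smul]; congr 1; ring
          _ = q₀ • σ' • (σ * a) • h₀ := by simp only [smul_smul]; congr 1; ring
          _ = (q₀ * β) • T := by rw [hβ, smul_smul]
      have h2 : ord Q q₀ ≤ ord Q (a * p₀) :=
        (ord_le_ord_iff Q).2 ⟨_, Q.1.isPrime.mul_notMem hσ' hσ, β, h1⟩
      rw [hk, ord_mul, add_comm] at h2
      exact (ENat.add_le_add_iff_right (ord_ne_top Q hp₀)).1 h2
    · intro h
      have h1 : ord Q q₀ ≤ ord Q (a * p₀) := by
        rw [hk, ord_mul, add_comm]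
        gcongr
      obtain ⟨σ, hσ, β, hβ⟩ := (ord_le_ord_iff Q).1 h1
      refine ⟨σ, hσ, ?_⟩
      rw [← map_smul, Submodule.mkQ_apply, Submodule.Quotient.mk_eq_zero]
      have h2 : (σ * a) • h₀ = β • T := by
        refine cancel (b := 0) hq₀ ?_
        calc q₀ • (σ * a) • h₀ = (σ * a) • q₀ • h₀ := smul_comm _ _ _
          _ = (σ * (a * p₀)) • T := by rw [h₀T, smul_smul]; congr 1; ring
          _ = q₀ • β • T := by rw [hβ, smul_smul]
      rw [h2]
      exact N.smul_mem β hTN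

theorem principalDivisor_apply {f : R} (hf : f ≠ 0) :
    (principalDivisor f Q : ℚ) = (ord Q f).toNat := by
  have hk : ord Q f = ord Q 1 + (ord Q f).toNat := by
    rw [ord_one, zero_add, ENat.natCast_toNat (ord_ne_top Q hf)]
  rw [principalDivisor, cycle]
  congr 1
  refine lengthAt_quotient_eq Q (T := f) (h₀ := (1 : R)) (q₀ := f) (p₀ := 1)
    (fun s h e => mul_eq_zero.1 e) hf (Ideal.mem_span_singleton_self f) ?_ hf ?_ hk ?_
  · intro z hz
    obtain ⟨b, rfl⟩ := Ideal.mem_span_singleton'.1 hz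
    exact ⟨1, (Ideal.ne_top_iff_one _).1 Q.1.isPrime.ne_top, b, one_smul _ _⟩
  · rw [smul_eq_mul, smul_eq_mul, mul_comm]
  · intro h
    refine ⟨f, h, hf, mul_comm _ _, ?_⟩
    rw [← zero_add (ord Q f), ← ord_one Q, ord_one, zero_add]
    conv_lhs => rw [hk, ord_one, zero_add]
    exact le_add_self

/-- In a Noetherian normal domain `f` divides `g` as soon as it does so at every prime of height
one: the associated primes of `R / (f)` have height one. -/
theorem dvd_of_forall_ord_le {f g : R} (hf : f ≠ 0)
    (h : ∀ Q : PrimeDivisor R, ord Q f ≤ ord Q g) : f ∣ g := by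
  by_contra hfg
  have hne : Ideal.Quotient.mk (Ideal.span {f}) g ≠ 0 := by
    rwa [ne_eq, Ideal.Quotient.eq_zero_iff_mem, Ideal.mem_span_singleton]
  obtain ⟨p, hp, hgp⟩ := exists_le_isAssociatedPrime_of_isNoetherianRing (R := R) _ hne
  rw [isAssociatedPrime_iff] at hp
  obtain ⟨hpp, y, hy⟩ := hp
  obtain ⟨b, rfl⟩ := Ideal.Quotient.mk_surjective y
  have hmem (r : R) : r ∈ p ↔ f ∣ r * b := by
    rw [hy, Submodule.mem_colon_singleton, Submodule.mem_bot, Algebra.smul_def,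
      Ideal.Quotient.algebraMap_eq, ← map_mul, Ideal.Quotient.eq_zero_iff_mem,
      Ideal.mem_span_singleton]
  have hfp : f ∈ p := (hmem f).2 (dvd_mul_right f b)
  have hfb : ¬ f ∣ b := fun hd => hpp.ne_top (p.eq_top_iff_one.2 ((hmem 1).2 (by rwa [one_mul])))
  -- if `(b / f) p ⊆ p`, then `b / f` is integral over `R`, hence in `R`
  obtain ⟨r, hr, u, hu, hru⟩ : ∃ r ∈ p, ∃ u, u ∉ p ∧ r * b = f * u := by
    by_contra! hcon
    let K := FractionRing R
    have hfK : algebraMap R K f ≠ 0 := by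
      rwa [ne_eq, map_eq_zero_iff _ (IsFractionRing.injective R K)]
    have hint : IsIntegral R (algebraMap R K b / algebraMap R K f) := by
      refine isIntegral_of_smul_mem_submodule (M := K)
        (Submodule.map (Algebra.linearMap R K) p) ?_
        (Submodule.FG.map _ (IsNoetherian.noetherian p)) _ ?_
      · refine (Submodule.ne_bot_iff _).2 ⟨algebraMap R K f, ⟨f, hfp, rfl⟩, hfK⟩
      · rintro _ ⟨r, hr, rfl⟩
        obtain ⟨u, hu⟩ := (hmem r).1 hr
        refine ⟨u, ?_, ?_⟩
        · by_contra hup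
          exact hcon r hr u hup hu
        · rw [Algebra.linearMap_apply, Algebra.linearMap_apply, smul_eq_mul, div_mul_eq_mul_div,
            eq_div_iff hfK, ← map_mul, ← map_mul, mul_comm u, ← hu, mul_comm]
    obtain ⟨c, hc⟩ := IsIntegrallyClosed.isIntegral_iff.1 hint
    refine hfb ⟨c, IsFractionRing.injective R K ?_⟩
    rw [map_mul, hc, mul_div_cancel₀ _ hfK]
  have hmin : p ∈ (Ideal.span {r}).minimalPrimes := by
    refine ⟨⟨hpp, (Ideal.span_singleton_le_iff_mem p).2 hr⟩, ?_⟩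
    rintro q ⟨hq, hrq⟩ hqp t ht
    obtain ⟨w, hw⟩ := (hmem t).1 ht
    have e : t * u = w * r := by
      refine mul_left_cancel₀ hf ?_
      calc f * (t * u) = t * (f * u) := by ring
        _ = (t * b) * r := by rw [← hru]; ring
        _ = f * (w * r) := by rw [hw]; ring
    have : t * u ∈ q := e ▸ q.mul_mem_left w (hrq (Ideal.mem_span_singleton_self r))
    exact (hq.mem_or_mem this).resolve_right fun hu' => hu (hqp hu')
  have hle := Ideal.height_le_one_of_isPrincipal_of_mem_minimalPrimes _ p hmin
  have hge : p.height ≠ 0 := by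
    rw [ne_eq, Ideal.height_eq_zero_iff_eq_bot]
    rintro rfl
    exact hf hfp
  have h1 : p.height = 1 := le_antisymm hle (Order.one_le_iff_ne_zero.2 hge)
  obtain ⟨σ, hσ, c, hc⟩ := (ord_le_ord_iff _).1 (h ⟨⟨p, hpp⟩, h1⟩)
  refine hσ (hgp ?_)
  rw [Submodule.mem_colon_singleton, Submodule.mem_bot, Algebra.smul_def,
    Ideal.Quotient.algebraMap_eq, ← map_mul, Ideal.Quotient.eq_zero_iff_mem,
    Ideal.mem_span_singleton]
  exact ⟨c, hc⟩

end Order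

/-! ### Pullback of divisors -/

section Pullback

variable {R : Type*} [CommRing R] [IsDomain R] [IsNoetherianRing R] [IsIntegrallyClosed R]
  {S : Type*} [CommRing S] [IsDomain S] [IsNoetherianRing S] [Algebra R S] [Module.Finite R S]

theorem ne_zero_of_ord_eq_natCast {P : PrimeDivisor R} {a : R} {m : ℕ} (h : ord P a = m) :
    a ≠ 0 := by
  rintro rfl
  rw [(ord_eq_top_iff P).2 rfl] at h
  exact ENat.top_ne_natCast _ h

theorem ne_zero_of_ord_eq_one {P : PrimeDivisor R} {a : R} (h : ord P a = 1) : a ≠ 0 :=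
  ne_zero_of_ord_eq_natCast (m := 1) (h.trans Nat.cast_one.symm)

/-- Prime divisors of `S` lie over prime divisors of `R`, by going down. -/
theorem height_comap_eq_one (hRS : Function.Injective (algebraMap R S)) (Q : PrimeDivisor S) :
    (Q.1.comap (algebraMap R S)).asIdeal.height = 1 := by
  refine le_antisymm ((height_comap_le hRS Q.1.asIdeal).trans Q.2.le) ?_
  rw [Order.one_le_iff_ne_zero, ne_eq, Ideal.height_eq_zero_iff_eq_bot]
  intro h
  exact Ideal.ne_bot_of_height_eq_one Q.2 (Ideal.eq_bot_of_comap_eq_bot (R := R) h)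

/-- The prime divisor of `R` below a prime divisor of `S`. -/
def below (hRS : Function.Injective (algebraMap R S)) (Q : PrimeDivisor S) : PrimeDivisor R :=
  ⟨Q.1.comap (algebraMap R S), height_comap_eq_one hRS Q⟩

section

variable [IsIntegrallyClosed S] (hRS : Function.Injective (algebraMap R S)) (Q : PrimeDivisor S)

theorem ord_algebraMap_mono {a b : R} (h : ord (below hRS Q) a ≤ ord (below hRS Q) b) :
    ord Q (algebraMap R S a) ≤ ord Q (algebraMap R S b) := by
  obtain ⟨σ, hσ, c, hc⟩ := (ord_le_ord_iff _).1 h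
  exact (ord_le_ord_iff _).2 ⟨algebraMap R S σ, hσ, algebraMap R S c, by
    rw [← map_mul, hc, map_mul]⟩

/-- The order along `Q` of an element of `R` is a multiple of its order along the prime divisor
below, the factor being the order of a uniformizer. -/
theorem ord_algebraMap {π : R} (hπ : ord (below hRS Q) π = 1) {a : R} (ha : a ≠ 0) :
    ord Q (algebraMap R S a) = (ord (below hRS Q) a).toNat • ord Q (algebraMap R S π) := by
  have h : ord (below hRS Q) a = ord (below hRS Q) (π ^ (ord (below hRS Q) a).toNat) := by
    rw [ord_pow, hπ, nsmul_eq_mul, mul_one, ENat.natCast_toNat (ord_ne_top _ ha)]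
  rw [← ord_pow, ← map_pow]
  exact le_antisymm (ord_algebraMap_mono hRS Q h.le) (ord_algebraMap_mono hRS Q h.ge)

theorem lengthAt_ramification {π : R} (hπ : ord (below hRS Q) π = 1) :
    lengthAt (S ⧸ (Q.1.comap (algebraMap R S)).asIdeal.map (algebraMap R S)) Q.1 =
      (ord Q (algebraMap R S π)).toNat := by
  have hπ0 : algebraMap R S π ≠ 0 := by
    rw [ne_eq, map_eq_zero_iff _ hRS]
    exact ne_zero_of_ord_eq_one hπ
  have hk : ord Q (algebraMap R S π) = ord Q 1 + (ord Q (algebraMap R S π)).toNat := by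
    rw [ord_one, zero_add, ENat.natCast_toNat (ord_ne_top Q hπ0)]
  refine lengthAt_quotient_eq Q (T := algebraMap R S π) (h₀ := (1 : S)) (p₀ := 1)
    (fun s h e => mul_eq_zero.1 e) hπ0 ?_ ?_ hπ0 ?_ hk ?_
  · exact Ideal.mem_map_of_mem _ ((one_le_ord_iff (below hRS Q)).1 hπ.ge)
  · intro z hz
    rw [Ideal.map] at hz
    induction hz using Submodule.span_induction with
    | mem z hz =>
      obtain ⟨r, hr, rfl⟩ := hz
      have h1 : ord (below hRS Q) π ≤ ord (below hRS Q) r :=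
        hπ.trans_le ((one_le_ord_iff (below hRS Q)).2 hr)
      obtain ⟨σ, hσ, c, hc⟩ := (ord_le_ord_iff Q).1 (ord_algebraMap_mono hRS Q h1)
      exact ⟨σ, hσ, c, by rw [smul_eq_mul, smul_eq_mul, hc, mul_comm]⟩
    | zero =>
      exact ⟨1, (Ideal.ne_top_iff_one _).1 Q.1.isPrime.ne_top, 0, by rw [smul_zero, zero_smul]⟩
    | add a b _ _ ha hb =>
      obtain ⟨σ, hσ, c, hc⟩ := ha
      obtain ⟨τ, hτ, e, he⟩ := hb
      refine ⟨σ * τ, Q.1.isPrime.mul_notMem hσ hτ, τ * c + σ * e, ?_⟩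
      rw [smul_add, add_smul, mul_smul, mul_smul τ, ← hc, mul_comm σ τ, mul_smul, mul_smul,
        smul_comm τ σ b, he]
      simp only [smul_eq_mul]
      ring
    | smul r a _ ha =>
      obtain ⟨σ, hσ, c, hc⟩ := ha
      exact ⟨σ, hσ, r * c, by rw [smul_comm, hc, mul_smul]⟩
  · rw [smul_eq_mul, smul_eq_mul, mul_comm]
  · intro h
    refine ⟨algebraMap R S π, h, hπ0, mul_comm _ _, ?_⟩
    conv_lhs => rw [hk, ord_one, zero_add]
    exact le_add_self

theorem pullback_apply {π : R} (hπ : ord (below hRS Q) π = 1) (D : PrimeDivisor R → ℚ) :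
    pullback S D Q = (ord Q (algebraMap R S π)).toNat * D (below hRS Q) := by
  rw [pullback, dif_pos (height_comap_eq_one hRS Q), lengthAt_ramification hRS Q hπ]
  rfl

end

theorem pullback_principalDivisor [IsIntegrallyClosed S]
    (hRS : Function.Injective (algebraMap R S)) {f : R} (hf : f ≠ 0) :
    pullback S (principalDivisor f) = principalDivisor (algebraMap R S f) := by
  funext Q
  obtain ⟨π, hπ⟩ := exists_ord_eq_one (below hRS Q)
  rw [pullback_apply hRS Q hπ, principalDivisor_apply _ hf,
    principalDivisor_apply _ ((map_ne_zero_iff _ hRS).2 hf), ord_algebraMap hRS Q hπ hf,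
    nsmul_eq_mul, ENat.toNat_mul, ENat.toNat_natCast, Nat.cast_mul, mul_comm]

end Pullback

theorem pullback_smul {R : Type*} [CommRing R] (S : Type*) [CommRing S] [Algebra R S] (c : ℚ)
    (D : PrimeDivisor R → ℚ) : pullback S (c • D) = c • pullback S D := by
  funext Q
  simp only [pullback, Pi.smul_apply, smul_eq_mul]
  split_ifs
  · exact mul_left_comm _ _ _
  · exact (mul_zero c).symm

/-! ### Principal divisors -/

section Principal

variable {R : Type*} [CommRing R] [IsDomain R] [IsNoetherianRing R] [IsIntegrallyClosed R]

theorem dvd_of_principalDivisor_le {f g : R} (hf : f ≠ 0) (hg : g ≠ 0)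
    (h : principalDivisor f ≤ principalDivisor g) : f ∣ g := by
  refine dvd_of_forall_ord_le hf fun Q => ?_
  have := h Q
  rw [principalDivisor_apply Q hf, principalDivisor_apply Q hg, Nat.cast_le] at this
  rw [← ENat.natCast_toNat (ord_ne_top Q hf), ← ENat.natCast_toNat (ord_ne_top Q hg)]
  exact_mod_cast this

theorem principalDivisor_mul {f g : R} (hf : f ≠ 0) (hg : g ≠ 0) :
    principalDivisor (f * g) = principalDivisor f + principalDivisor g := by
  funext Q
  rw [Pi.add_apply, principalDivisor_apply Q hf, principalDivisor_apply Q hg,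
    principalDivisor_apply Q (mul_ne_zero hf hg), ord_mul,
    ENat.toNat_add (ord_ne_top Q hf) (ord_ne_top Q hg), Nat.cast_add]

theorem principalDivisor_pow {f : R} (hf : f ≠ 0) (n : ℕ) :
    principalDivisor (f ^ n) = (n : ℚ) • principalDivisor f := by
  funext Q
  rw [Pi.smul_apply, principalDivisor_apply Q hf, principalDivisor_apply Q (pow_ne_zero n hf),
    ord_pow, nsmul_eq_mul, ENat.toNat_mul, ENat.toNat_natCast, Nat.cast_mul, smul_eq_mul]

/-- An effective `ℚ`-Cartier divisor has a multiple which is the divisor of an element of `R`. -/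
theorem IsQCartier.exists_of_nonneg {Γ : PrimeDivisor R → ℚ} (hΓ : IsQCartier Γ) (h0 : 0 ≤ Γ) :
    ∃ (n : ℕ) (f : R), 0 < n ∧ f ≠ 0 ∧ (n : ℚ) • Γ = principalDivisor f := by
  obtain ⟨n, hn, f, g, hf, hg, h⟩ := hΓ
  have h1 : principalDivisor g ≤ principalDivisor f := by
    rw [← sub_nonneg, ← h]
    exact smul_nonneg (Nat.cast_nonneg n) h0
  obtain ⟨c, rfl⟩ := dvd_of_principalDivisor_le hg hf h1
  have hc : c ≠ 0 := right_ne_zero_of_mul hf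
  exact ⟨n, c, hn, hc, by rw [h, principalDivisor_mul hg hc, add_sub_cancel_left]⟩

end Principal

/-! ### Roots in the absolute integral closure -/

section Roots

variable {R : Type*} [CommRing R] [IsDomain R] {P : Type*} [CommRing P] [Algebra R P]

theorem IsAbsoluteIntegralClosure.exists_pow_eq (hP : IsAbsoluteIntegralClosure R P) {n : ℕ}
    (hn : 0 < n) (a : P) : ∃ b : P, b ^ n = a := by
  obtain ⟨e⟩ := hP
  obtain ⟨z, hz⟩ := IsAlgClosed.exists_pow_nat_eq (e a : AlgebraicClosure (FractionRing R)) hn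
  have hint : IsIntegral R z := IsIntegral.of_pow hn (hz ▸ (e a).2)
  refine ⟨e.symm ⟨z, hint⟩, e.injective (Subtype.ext ?_)⟩
  rw [map_pow, e.apply_symm_apply]
  exact hz

/-- Elements of `R⁺` with associated `N`-th powers are associated. -/
theorem IsAbsoluteIntegralClosure.exists_unit_mul_eq (hP : IsAbsoluteIntegralClosure R P) {N : ℕ}
    (hN : 0 < N) {a b : P} {u : Pˣ} (h : a ^ N = u * b ^ N) : ∃ w : Pˣ, a = w * b := by
  obtain ⟨e⟩ := hP
  let Ω := AlgebraicClosure (FractionRing R)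
  let j : P →+* Ω := (algebraMap (integralClosure R Ω) Ω).comp (e : P →+* integralClosure R Ω)
  have hj : Function.Injective j := Subtype.val_injective.comp e.injective
  have hjint (c : P) : IsIntegral R (j c) := (e c).2
  have hsurj {z : Ω} (hz : IsIntegral R z) : ∃ c, j c = z :=
    ⟨e.symm ⟨z, hz⟩, congrArg Subtype.val (e.apply_symm_apply ⟨z, hz⟩)⟩
  have hjh : j a ^ N = j u * j b ^ N := by rw [← map_pow, h, map_mul, map_pow]
  by_cases hb : j b = 0
  · rw [hb, zero_pow hN.ne', mul_zero] at hjh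
    refine ⟨1, hj ?_⟩
    rw [map_mul, hb, mul_zero, pow_eq_zero_iff hN.ne' |>.1 hjh]
  · have hu : j u * j (u⁻¹ : Pˣ) = 1 := by rw [← map_mul, Units.mul_inv, map_one]
    have ha : j a ≠ 0 := by
      intro ha
      rw [ha, zero_pow hN.ne'] at hjh
      exact (mul_ne_zero (left_ne_zero_of_mul_eq_one hu) (pow_ne_zero N hb)) hjh.symm
    obtain ⟨w, hw⟩ := hsurj (z := j a / j b) (IsIntegral.of_pow hN (by
      rw [div_pow, hjh, mul_div_cancel_right₀ _ (pow_ne_zero N hb)]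
      exact hjint _))
    obtain ⟨w', hw'⟩ := hsurj (z := j b / j a) (IsIntegral.of_pow hN (by
      have : (j b / j a) ^ N = j (u⁻¹ : Pˣ) := by
        rw [div_pow, div_eq_iff (pow_ne_zero N ha), hjh, ← mul_assoc, mul_comm (j _) (j u), hu,
          one_mul]
      rw [this]
      exact hjint _))
    have hww : w * w' = 1 := hj (by
      rw [map_mul, hw, hw', map_one, div_mul_div_cancel₀ hb, div_self ha])
    refine ⟨⟨w, w', hww, by rw [mul_comm, hww]⟩, hj ?_⟩
    rw [map_mul]
    change j a = j w * j b
    rw [hw, div_mul_cancel₀ _ hb]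

end Roots

/-! ### Independence of the choices in the definition of the test submodule -/

section ZeroSet

variable {R : Type*} [CommRing R] [IsDomain R] [IsNoetherianRing R] [IsIntegrallyClosed R]
  {R₀ : Type*} [CommRing R₀] [IsDomain R₀] {d : ℕ} (x : Fin d → R)
  {P : Type*} [CommRing P] [Algebra R₀ P] [Algebra R P]
  {B : Type*} [CommRing B] [Algebra R B] [Algebra P B]

/-- `zeroSet x P B Γ` is the kernel of `f^{1/n}` for any single choice of `n`, `f` and `f^{1/n}`:
two choices of the root differ by a unit of `P`. -/
theorem mem_zeroSet_iff (hP : IsAbsoluteIntegralClosure R₀ P) {Γ : PrimeDivisor R → ℚ} {n : ℕ}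
    {f : R} {g : P} (hn : 0 < n) (hf : f ≠ 0) (hΓ : (n : ℚ) • Γ = principalDivisor f)
    (hg : g ^ n = algebraMap R P f) (η : TopLocalCohomology x R) :
    η ∈ zeroSet x P B Γ ↔ topLocalCohomologyMap x
      (LinearMap.mulLeft R (algebraMap P B g) ∘ₗ Algebra.linearMap R B) η = 0 := by
  refine ⟨?_, fun h => ⟨n, f, g, hn, hf, hΓ, hg, h⟩⟩
  rintro ⟨m, f', g', hm, hf', hΓ', hg', h⟩
  have hdiv : principalDivisor (f ^ m) = principalDivisor (f' ^ n) := by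
    rw [principalDivisor_pow hf, principalDivisor_pow hf', ← hΓ, ← hΓ', smul_smul, smul_smul,
      mul_comm]
  have hassoc : Associated (f' ^ n) (f ^ m) :=
    associated_of_dvd_dvd
      (dvd_of_principalDivisor_le (pow_ne_zero n hf') (pow_ne_zero m hf) hdiv.ge)
      (dvd_of_principalDivisor_le (pow_ne_zero m hf) (pow_ne_zero n hf') hdiv.le)
  obtain ⟨u, hu⟩ := hassoc
  obtain ⟨w, hw⟩ := hP.exists_unit_mul_eq (Nat.mul_pos hn hm) (a := g) (b := g')
    (u := u.map (algebraMap R P).toMonoidHom) (by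
      rw [pow_mul, hg, mul_comm n m, pow_mul, hg', ← map_pow, ← hu, map_mul, map_pow, mul_comm]
      rfl)
  obtain ⟨t, r, rfl⟩ := exists_topFrac x η
  rw [topLocalCohomologyMap_topFrac] at h ⊢
  have e : (LinearMap.mulLeft R (algebraMap P B g) ∘ₗ Algebra.linearMap R B) r =
      LinearMap.mulLeft R (algebraMap P B w)
        ((LinearMap.mulLeft R (algebraMap P B g') ∘ₗ Algebra.linearMap R B) r) := by
    rw [hw]
    simp
  rw [e, ← topLocalCohomologyMap_topFrac, h, map_zero]

end ZeroSet

/-! ### The transformation rule for test submodules -/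

section TestSubmodule

/-- Endomorphisms of a finitely generated fractional ideal over a normal domain are
multiplications by elements of the domain. -/
theorem exists_eq_smul_of_fg {S : Type*} [CommRing S] [IsDomain S] [IsIntegrallyClosed S]
    {L : Type*} [Field L] [Algebra S L] [IsFractionRing S L] {ω : Submodule S L} (hω : ω.FG)
    (h : ω →ₗ[S] ω) : ∃ s : S, ∀ z, h z = s • z := by
  by_cases h0 : ω = ⊥
  · subst h0
    exact ⟨0, fun z => Subsingleton.elim _ _⟩
  · obtain ⟨z₀, hz₀, hne⟩ := (Submodule.ne_bot_iff _).1 h0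
    have key (z : ω) : (h z : L) = (h ⟨z₀, hz₀⟩ / z₀) * z := by
      obtain ⟨p, q, hq, hpq⟩ := IsFractionRing.div_surjective S ((z : L) / z₀)
      have hq0 : algebraMap S L q ≠ 0 := by
        rw [ne_eq, map_eq_zero_iff _ (IsFractionRing.injective S L)]
        exact nonZeroDivisors.ne_zero hq
      have e1 : q • z = p • (⟨z₀, hz₀⟩ : ω) := by
        apply Subtype.ext
        change q • (z : L) = p • z₀
        rw [Algebra.smul_def, Algebra.smul_def]
        field_simp at hpq
        rw [hpq, mul_comm]
      have e2 := congrArg (fun w : ω => (w : L)) (congrArg h e1)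
      have e3 := congrArg (fun w : ω => (w : L)) e1
      simp only [map_smul, Submodule.coe_smul, Algebra.smul_def] at e2 e3
      refine mul_left_cancel₀ hq0 ?_
      rw [e2, mul_left_comm, e3, ← mul_assoc, mul_comm _ (algebraMap S L p), mul_assoc,
        div_mul_cancel₀ _ hne]
    have hint := isIntegral_of_smul_mem_submodule ω h0 hω ((h ⟨z₀, hz₀⟩ : L) / z₀)
      (fun n hn => by rw [smul_eq_mul, ← key ⟨n, hn⟩]; exact (h ⟨n, hn⟩).2)
    obtain ⟨s, hs⟩ := IsIntegrallyClosed.isIntegral_iff.1 hint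
    exact ⟨s, fun z => Subtype.ext (by rw [key, ← hs, Submodule.coe_smul, Algebra.smul_def])⟩

section BaseChange

variable {R : Type u} [CommRing R] {S : Type v} [CommRing S] [Algebra R S] {d : ℕ} (x : Fin d → R)

theorem map_prod_params : ∏ i, algebraMap R S (x i) = algebraMap R S (∏ i, x i) :=
  (map_prod _ _ _).symm

/-- The map `H^d_𝔪(R) → H^d(S)` for a ring extension, with the top local cohomology of `S` computed
over `S` by the images of the parameters. -/
theorem exists_baseChangeMap :
    ∃ ψ : TopLocalCohomology x R →ₗ[R] TopLocalCohomology (fun i => algebraMap R S (x i)) S,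
      ∀ t r, ψ (topFrac x t r) =
        topFrac (fun i => algebraMap R S (x i)) t (algebraMap R S r) := by
  let φ (t : ℕ) : R →ₗ[R] TopLocalCohomology (fun i => algebraMap R S (x i)) S :=
    LinearMap.toSpanSingleton R _ (topFrac (fun i => algebraMap R S (x i)) t (1 : S))
  have hφ (t : ℕ) (r : R) : φ t r =
      topFrac (fun i => algebraMap R S (x i)) t (algebraMap R S r) := by
    change r • topFrac (fun i => algebraMap R S (x i)) t (1 : S) = _
    rw [← algebraMap_smul S r (topFrac (fun i => algebraMap R S (x i)) t (1 : S)), ← map_smul,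
      smul_eq_mul, mul_one]
  have key := exists_topLift x φ ?_ ?_
  · obtain ⟨ψ, hψ⟩ := key
    exact ⟨ψ, fun t r => (hψ t r).trans (hφ t r)⟩
  · intro t m
    rw [hφ, hφ, smul_eq_mul, map_mul, ← map_prod_params, ← smul_eq_mul, topFrac_succ]
  · intro t i m
    rw [hφ, smul_eq_mul, map_mul, map_pow, ← smul_eq_mul]
    exact topFrac_pow_smul (fun i => algebraMap R S (x i)) t i _

/-- `H^d(S)` is the base change of `H^d_𝔪(R)`: an `R`-bilinear pairing of `S` and `H^d_𝔪(R)` with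
values in `E` is induced by an `S`-linear map `H^d(S) → F`, if `F ≅ Hom_R(S, E)`. -/
theorem exists_hom_of_pairing {E : Type*} [AddCommGroup E] [Module R E] {F : Type*}
    [AddCommGroup F] [Module R F] [Module S F] {θ : F →ₗ[R] E} (hθ : IsDualityTrace S θ)
    (β : S →ₗ[R] TopLocalCohomology x R →ₗ[R] E) :
    ∃ φ : TopLocalCohomology (fun i => algebraMap R S (x i)) S →ₗ[S] F,
      ∀ s t r, θ (s • φ (topFrac (fun i => algebraMap R S (x i)) t (algebraMap R S r))) =
        β s (topFrac x t r) := by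
  choose a ha using fun t : ℕ => hθ.2 (β.flip (topFrac x t (1 : R)))
  have ha' (t : ℕ) (s : S) : θ (s • a t) = β s (topFrac x t (1 : R)) := ha t s
  have hr (s : S) (t : ℕ) (r : R) :
      θ ((s * algebraMap R S r) • a t) = β s (topFrac x t r) := by
    rw [ha', mul_comm, ← Algebra.smul_def, map_smul, LinearMap.smul_apply, ← map_smul, ← map_smul,
      smul_eq_mul, mul_one]
  have key := exists_topLift (fun i => algebraMap R S (x i))
    (fun t => LinearMap.toSpanSingleton S F (a t)) ?_ ?_
  · obtain ⟨φ, hφ⟩ := key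
    refine ⟨φ, fun s t r => ?_⟩
    rw [hφ, LinearMap.toSpanSingleton_apply, smul_smul, hr]
  · intro t m
    refine sub_eq_zero.1 (hθ.1 _ fun s => ?_)
    have h1 := topFrac_succ x t (1 : R)
    rw [smul_eq_mul, mul_one] at h1
    rw [LinearMap.toSpanSingleton_apply, LinearMap.toSpanSingleton_apply, smul_sub, map_sub,
      map_prod_params, smul_eq_mul, mul_comm (algebraMap R S _), smul_smul, smul_smul,
      ← mul_assoc, hr, h1, ha', sub_self]
  · intro t i m
    refine hθ.1 _ fun s => ?_
    have h1 := topFrac_pow_smul x t i (1 : R)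
    rw [smul_eq_mul, mul_one] at h1
    rw [LinearMap.toSpanSingleton_apply, smul_eq_mul, mul_comm (_ ^ t), smul_smul, ← mul_assoc,
      ← map_pow, hr, h1, map_zero]

/-- Vanishing of a class in the top local cohomology of an `S`-module can be tested over `R`. -/
theorem topFrac_algebraMap_eq_zero_iff {M : Type*} [AddCommGroup M] [Module R M] [Module S M]
    [IsScalarTower R S M] (t : ℕ) (m : M) :
    topFrac (fun i => algebraMap R S (x i)) t m = 0 ↔ topFrac x t m = 0 := by
  rw [topFrac_eq_zero_iff, topFrac_eq_zero_iff, map_prod_params]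
  simp only [← map_pow, algebraMap_smul]

end BaseChange

/-- `Tr (τ_B(ω_S, φ^* Γ)) = τ_B(ω_R, Γ)` for an effective `ℚ`-Cartier divisor `Γ`: the kernel of
`f^{1/n}` on `H^d_𝔪(R)` is the preimage of its kernel on `H^d_𝔪(S)`. -/
theorem map_testSubmodule_eq
    {R : Type u} [CommRing R] [IsDomain R] [IsLocalRing R] [IsNoetherianRing R]
    [IsIntegrallyClosed R]
    {S : Type v} [CommRing S] [IsDomain S] [IsLocalRing S] [IsNoetherianRing S]
    [IsIntegrallyClosed S]
    [Algebra R S] [Module.Finite R S] (hRS : Function.Injective (algebraMap R S))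
    {P : Type*} [CommRing P] [Algebra R P] [Algebra S P] [IsScalarTower R S P]
    (hP : IsAbsoluteIntegralClosure R P)
    {B : Type*} [CommRing B] [Algebra P B] [Algebra R B] [Algebra S B]
    [IsScalarTower R P B] [IsScalarTower S P B]
    {K : Type*} [Field K] [Algebra R K]
    {L : Type*} [Field L] [Algebra S L] [IsFractionRing S L] [Algebra R L] [IsScalarTower R S L]
    {d : ℕ} {x : Fin d → R} (hx : IsSystemOfParameters x)
    {e : ℕ} {y : Fin e → S} (hy : IsSystemOfParameters y)
    {E : Type u} [AddCommGroup E] [Module R E] (hE : IsInjectiveHullOfResidueField R E)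
    {F : Type v} [AddCommGroup F] [Module S F] (hF : IsInjectiveHullOfResidueField S F)
    (ωR : CanonicalIdeal K x E) (ωS : CanonicalIdeal L y F)
    (Tr : ωS.carrier →ₗ[R] ωR.carrier) (hTr : IsGrothendieckTrace (S := S) Tr)
    {Γ : PrimeDivisor R → ℚ} (hΓ0 : 0 ≤ Γ) (hΓ : IsQCartier Γ) :
    ((testSubmodule P B ωS (pullback S Γ)).restrictScalars R).map Tr =
      testSubmodule P B ωR Γ := by
  have hx' := hx.map hRS
  obtain rfl : e = d := by
    have := hy.1.symm.trans hx'.1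
    exact_mod_cast this
  -- a single `f^{1/n}` computes both kernels
  obtain ⟨n, f, hn, hf, hnΓ⟩ := hΓ.exists_of_nonneg hΓ0
  obtain ⟨g, hg⟩ := hP.exists_pow_eq hn (algebraMap R P f)
  have hnΓS : (n : ℚ) • pullback S Γ = principalDivisor (algebraMap R S f) := by
    rw [← pullback_smul, hnΓ, pullback_principalDivisor hRS hf]
  have hgS : g ^ n = algebraMap S P (algebraMap R S f) := by
    rw [hg, ← IsScalarTower.algebraMap_apply]
  let mR : R →ₗ[R] B := LinearMap.mulLeft R (algebraMap P B g) ∘ₗ Algebra.linearMap R B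
  let mS : S →ₗ[S] B := LinearMap.mulLeft S (algebraMap P B g) ∘ₗ Algebra.linearMap S B
  have hRSB : IsScalarTower R S B := IsScalarTower.of_algebraMap_eq fun r => by
    rw [IsScalarTower.algebraMap_apply R P B, IsScalarTower.algebraMap_apply S P B,
      ← IsScalarTower.algebraMap_apply R S P]
  have hmRS (r : R) : mS (algebraMap R S r) = mR r := by
    change algebraMap P B g * algebraMap S B (algebraMap R S r) =
      algebraMap P B g * algebraMap R B r
    rw [← IsScalarTower.algebraMap_apply]
  let _ : Module R F := Module.compHom F (algebraMap R S)
  have : IsScalarTower R S F := ⟨fun r s a => by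
    rw [Algebra.smul_def, mul_smul]; rfl⟩
  let X := TopLocalCohomology (fun i => algebraMap R S (x i)) S
  obtain ⟨θ, hθ⟩ := exists_isDualityTrace hE hF
  obtain ⟨ψ, hψ⟩ := exists_baseChangeMap (S := S) x
  obtain ⟨e₁, e₂, he⟩ := exists_topLocalCohomology_equiv hx' hy mS
  have : Module.Injective R E := hE.1
  let Ψ : TopLocalCohomology x R →ₗ[R] TopLocalCohomology y S :=
    (e₁ : X →ₗ[S] TopLocalCohomology y S).restrictScalars R ∘ₗ ψ
  have hspan : Submodule.span S (Set.range Ψ) = ⊤ := by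
    rw [eq_top_iff]
    intro η _
    obtain ⟨η, rfl⟩ := e₁.surjective η
    obtain ⟨t, s, rfl⟩ := exists_topFrac _ η
    have h1 : e₁ (topFrac (fun i => algebraMap R S (x i)) t s) = s • Ψ (topFrac x t 1) := by
      change _ = s • e₁ (ψ (topFrac x t 1))
      rw [hψ, ← map_smul, ← map_smul, map_one, smul_eq_mul, mul_one]
    rw [h1]
    exact Submodule.smul_mem _ _ (Submodule.subset_span ⟨_, rfl⟩)
  have hext (β : S →ₗ[R] TopLocalCohomology x R →ₗ[R] E) :
      ∃ φ : TopLocalCohomology y S →ₗ[S] F, ∀ s a, θ (s • φ (Ψ a)) = β s a := by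
    obtain ⟨φ, hφ⟩ := exists_hom_of_pairing x hθ β
    refine ⟨φ ∘ₗ e₁.symm, fun s a => ?_⟩
    obtain ⟨t, r, rfl⟩ := exists_topFrac x a
    rw [← hφ, ← hψ]
    change θ (s • φ (e₁.symm (e₁ (ψ _)))) = _
    rw [e₁.symm_apply_apply]
  have hN (a : TopLocalCohomology x R) :
      a ∈ LinearMap.ker (topLocalCohomologyMap x mR) ↔
        Ψ a ∈ LinearMap.ker (topLocalCohomologyMap y mS) := by
    obtain ⟨t, r, rfl⟩ := exists_topFrac x a
    rw [LinearMap.mem_ker, LinearMap.mem_ker]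
    change _ ↔ topLocalCohomologyMap y mS (e₁ (ψ _)) = 0
    rw [he, map_eq_zero_iff _ e₂.injective, hψ, topLocalCohomologyMap_topFrac,
      topLocalCohomologyMap_topFrac, hmRS, topFrac_algebraMap_eq_zero_iff]
  have key := exists_trace_eq_iff hθ Ψ hext hspan ωR.duality ωS.duality
    (exists_eq_smul_of_fg ωS.fg) hTr _ _ hN
  ext w
  have hkerR (η) := mem_zeroSet_iff (B := B) x hP hn hf hnΓ hg η
  have hkerS (η) := mem_zeroSet_iff (B := B) y hP hn ((map_ne_zero_iff _ hRS).2 hf) hnΓS hgS η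
  constructor
  · rintro ⟨z, hz, rfl⟩ η hη
    refine (key (Tr z)).1 ⟨z, fun a ha => hz a ?_, rfl⟩ η ?_
    · exact (hkerS a).2 ha
    · exact (hkerR η).1 hη
  · intro hw
    obtain ⟨z, hz, hzw⟩ := (key w).2 fun a ha => hw a ((hkerR a).2 ha)
    exact ⟨z, fun η hη => hz η ((hkerS η).1 hη), hzw⟩

end TestSubmodule

/-! ### Poles of fractional ideals -/

section Poles

variable {S : Type*} [CommRing S]

/-- If `I` is finitely generated and each of its elements lies in `J` after multiplication by some
`σ ∉ Q`, then a single `σ` serves for all of them. -/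
theorem exists_notMem_smul_mem {I J : Ideal S} (hI : I.FG) (Q : PrimeDivisor S)
    (h : ∀ s ∈ I, ∃ σ ∉ Q.1.asIdeal, σ * s ∈ J) :
    ∃ σ ∉ Q.1.asIdeal, ∀ s ∈ I, σ * s ∈ J := by
  obtain ⟨G, rfl⟩ := hI
  choose! σ hσ hσJ using h
  refine ⟨∏ g ∈ G, σ g, ?_, fun s hs => ?_⟩
  · rw [Ideal.IsPrime.prod_mem_iff]
    rintro ⟨g, hg, h⟩
    exact hσ g (Ideal.subset_span hg) h
  · induction hs using Submodule.span_induction with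
    | mem g hg =>
      obtain ⟨c, hc⟩ := Finset.dvd_prod_of_mem σ hg
      rw [hc, mul_comm (σ g), mul_assoc]
      exact J.mul_mem_left _ (hσJ g (Ideal.subset_span hg))
    | zero => simp
    | add a b _ _ ha hb => rw [mul_add]; exact J.add_mem ha hb
    | smul r a _ ha => rw [smul_eq_mul, mul_left_comm]; exact J.mul_mem_left _ ha

variable [IsDomain S] [IsNoetherianRing S] [IsIntegrallyClosed S]
  {L : Type*} [Field L] [Algebra S L] [IsFractionRing S L]

/-- Let `b` be the largest order of a pole along `Q` of an element of a finitely generated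
fractional ideal `M ∋ 1`. It is attained by some `z₀ = p / q`, and there is a `t ∈ S` of order
exactly `b` with `t M ⊆ S`. -/
theorem exists_pole (Q : PrimeDivisor S) {M : Submodule S L} (hM : M.FG) (h1 : (1 : L) ∈ M) :
    ∃ (b : ℕ) (z₀ : M) (p q t : S) (c : M →ₗ[S] S), q ≠ 0 ∧ q • z₀ = p • ⟨1, h1⟩ ∧
      ord Q q = ord Q p + b ∧ ord Q t = b ∧ ∀ z : M, algebraMap S L (c z) = t • (z : L) := by
  have hinj := IsFractionRing.injective S L
  obtain ⟨D, hD, hDM⟩ := FractionalIdeal.isFractional_of_fg (S := nonZeroDivisors S) hM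
  have hD0 : D ≠ 0 := nonZeroDivisors.ne_zero hD
  -- the ideal `D M`, generated at `Q` by any element `s₀` of least order
  let I : Ideal S := (M.map (LinearMap.lsmul S L D)).comap (Algebra.linearMap S L)
  have hI {s : S} : s ∈ I ↔ ∃ z ∈ M, D • z = algebraMap S L s := Iff.rfl
  have hDI : D ∈ I := hI.2 ⟨1, h1, by rw [Algebra.smul_def, mul_one]⟩
  obtain ⟨s₀, hs₀, hmin⟩ := WellFounded.has_min (InvImage.wf (ord Q) wellFounded_lt)
    (I : Set S) ⟨D, hDI⟩
  have hle (s : S) (hs : s ∈ I) : ord Q s₀ ≤ ord Q s := not_lt.1 (hmin s hs)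
  have hs₀0 : s₀ ≠ 0 := by
    rintro rfl
    have := hle D hDI
    rw [(ord_eq_top_iff Q).2 rfl, top_le_iff, ord_eq_top_iff] at this
    exact hD0 this
  obtain ⟨σ, hσ, hσI⟩ := exists_notMem_smul_mem (J := Ideal.span {s₀})
    (IsNoetherian.noetherian I) Q fun s hs => by
      obtain ⟨σ, hσ, c, hc⟩ := (ord_le_ord_iff Q).1 (hle s hs)
      exact ⟨σ, hσ, Ideal.mem_span_singleton'.2 ⟨c, by rw [hc, mul_comm]⟩⟩
  obtain ⟨t, ht⟩ := Ideal.mem_span_singleton'.1 (hσI D hDI)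
  obtain ⟨z₀, hz₀, hDz₀⟩ := hI.1 hs₀
  have htD : ord Q D = ord Q s₀ + ord Q t := by
    have := congrArg (ord Q) ht
    rw [ord_mul, ord_mul, (ord_eq_zero_iff Q).2 hσ, zero_add] at this
    rw [← this, add_comm]
  have ht0 : t ≠ 0 := by
    rintro rfl
    rw [zero_mul] at ht
    exact (mul_ne_zero (ne_of_mem_of_not_mem Q.1.asIdeal.zero_mem hσ).symm hD0) ht.symm
  have htM (z : M) : ∃ s, algebraMap S L s = t • (z : L) := by
    obtain ⟨s, hs⟩ := hDM z z.2
    obtain ⟨c, hc⟩ := Ideal.mem_span_singleton'.1 (hσI s (hI.2 ⟨z, z.2, hs.symm⟩))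
    refine ⟨c, ?_⟩
    have h2 : algebraMap S L s₀ ≠ 0 := by rwa [ne_eq, map_eq_zero_iff _ hinj]
    refine mul_right_cancel₀ h2 ?_
    rw [← map_mul, hc, map_mul, hs, Algebra.smul_def, Algebra.smul_def, ← mul_assoc, ← map_mul,
      ← ht, map_mul]
    ring
  let c : M →ₗ[S] S :=
    (LinearEquiv.ofInjective (Algebra.linearMap S L) hinj).symm.toLinearMap ∘ₗ
      (LinearMap.lsmul S L t ∘ₗ M.subtype).codRestrict _ htM
  refine ⟨(ord Q t).toNat, ⟨z₀, hz₀⟩, s₀, D, t, c, hD0, ?_, ?_, ?_, ?_⟩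
  · apply Subtype.ext
    change D • z₀ = s₀ • (1 : L)
    rw [hDz₀, Algebra.smul_def, mul_one]
  · rw [htD, ENat.natCast_toNat (ord_ne_top Q ht0)]
  · rw [ENat.natCast_toNat (ord_ne_top Q ht0)]
  · intro z
    exact congrArg Subtype.val
      ((LinearEquiv.ofInjective (Algebra.linearMap S L) hinj).apply_symm_apply _)

theorem lengthAt_of_pole (Q : PrimeDivisor S) {M : Submodule S L} {h1 : (1 : L) ∈ M}
    {b : ℕ} {z₀ : M} {p q t : S} {c : M →ₗ[S] S} (hq : q ≠ 0) (hz₀ : q • z₀ = p • ⟨1, h1⟩)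
    (hb : ord Q q = ord Q p + b) (ht : ord Q t = b)
    (hc : ∀ z : M, algebraMap S L (c z) = t • (z : L)) :
    lengthAt (M ⧸ (1 : Submodule S L).submoduleOf M) Q.1 = b := by
  refine lengthAt_quotient_eq Q (T := (⟨1, h1⟩ : M)) (h₀ := z₀) (p₀ := p) (q₀ := q)
    (fun s h e => ?_) (fun h => one_ne_zero (congrArg Subtype.val h)) ?_ ?_ hq hz₀ hb ?_
  · have := congrArg Subtype.val e
    rw [Submodule.coe_smul, Algebra.smul_def, Submodule.coe_zero, mul_eq_zero,
      map_eq_zero_iff _ (IsFractionRing.injective S L)] at this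
    exact this.imp id fun h => Subtype.ext h
  · exact Submodule.mem_comap.2 (Submodule.mem_one.2 ⟨1, map_one _⟩)
  · rintro z hz
    obtain ⟨s, hs⟩ := Submodule.mem_one.1 (Submodule.mem_comap.1 hz)
    refine ⟨1, (Ideal.ne_top_iff_one _).1 Q.1.isPrime.ne_top, s, Subtype.ext ?_⟩
    rw [one_smul]
    change (z : L) = s • (1 : L)
    rw [Algebra.smul_def, mul_one]
    exact hs.symm
  · intro z
    refine ⟨t, c z, ne_zero_of_ord_eq_natCast ht, Subtype.ext ?_, ht.trans_le le_add_self⟩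
    change t • (z : L) = c z • (1 : L)
    rw [← hc, Algebra.smul_def, mul_one]

end Poles

/-! ### Ramification and canonical divisors -/

section Ramification

variable {R : Type*} [CommRing R] [IsDomain R] {S : Type*} [CommRing S] [Algebra R S]
  [Module.Finite R S]

theorem HomDual.smul_eq_zero [IsDomain S] {s : S} {h : HomDual R S} (e : s • h = 0) :
    s = 0 ∨ h = 0 := by
  by_contra! hcon
  obtain ⟨r, hr, a, ha⟩ := (Algebra.IsAlgebraic.isAlgebraic (R := R) s).exists_nonzero_dvd
    (mem_nonZeroDivisors_of_ne_zero hcon.1)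
  refine hcon.2 (LinearMap.ext fun u => (mul_eq_zero.1 ?_).resolve_left hr)
  have := DFunLike.congr_fun (F := S →ₗ[R] R) e (a * u)
  change DFunLike.coe (F := S →ₗ[R] R) h (s * (a * u)) = 0 at this
  rw [← mul_assoc, ← ha, ← Algebra.smul_def] at this
  rw [← smul_eq_mul]
  exact (LinearMap.map_smul h r u).symm.trans this

/-- There is a nonzero `R`-linear map `S → R`: take a functional on `S ⊗ Frac R` and clear
denominators. -/
theorem HomDual.exists_ne_zero (hRS : Function.Injective (algebraMap R S)) :
    ∃ h : HomDual R S, h ≠ 0 := by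
  let K := FractionRing R
  let V := LocalizedModule (nonZeroDivisors R) S
  let ι : S →ₗ[R] V := LocalizedModule.mkLinearMap (nonZeroDivisors R) S
  have hι : ι 1 ≠ 0 := by
    intro h
    rw [← map_zero ι] at h
    obtain ⟨c, hc⟩ := (IsLocalizedModule.eq_iff_exists (nonZeroDivisors R) ι).1 h
    rw [smul_zero] at hc
    change (c : R) • (1 : S) = 0 at hc
    rw [Algebra.smul_def, mul_one, map_eq_zero_iff _ hRS] at hc
    exact nonZeroDivisors.ne_zero c.2 hc
  obtain ⟨φ, hφ⟩ : ∃ φ : Module.Dual K V, φ (ι 1) ≠ 0 := by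
    by_contra! h
    exact hι ((Module.forall_dual_apply_eq_zero_iff K _).1 h)
  let φR : S →ₗ[R] K := φ.restrictScalars R ∘ₗ ι
  obtain ⟨r, hr, hrφ⟩ := FractionalIdeal.isFractional_of_fg (S := nonZeroDivisors R)
    (I := LinearMap.range φR) (by
      rw [LinearMap.range_eq_map]
      exact Module.Finite.fg_top.map φR)
  have hinj := IsFractionRing.injective R K
  let e := LinearEquiv.ofInjective (Algebra.linearMap R K) hinj
  let h : S →ₗ[R] R := e.symm.toLinearMap ∘ₗ
    (r • φR).codRestrict _ fun s => hrφ _ ⟨s, rfl⟩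
  refine ⟨HomDual.of h, fun h0 => ?_⟩
  have h1 : h 1 = 0 := DFunLike.congr_fun (F := S →ₗ[R] R) h0 1
  have h2 : r • φR 1 = 0 := congrArg Subtype.val
    (e.symm.injective (h1.trans (map_zero e.symm).symm))
  rw [Algebra.smul_def, mul_eq_zero, map_eq_zero_iff _ hinj] at h2
  exact h2.elim (nonZeroDivisors.ne_zero hr) hφ

variable [IsNoetherianRing R] [IsIntegrallyClosed R]
  [IsDomain S] [IsNoetherianRing S] [IsIntegrallyClosed S]
  {K : Type*} [Field K] [Algebra R K] [IsFractionRing R K]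
  {L : Type*} [Field L] [Algebra S L] [IsFractionRing S L] [Algebra R L] [IsScalarTower R S L]

/-- The formula `K_S = φ^* K_R + Ram`. Near `Q`, multiplication by `t` and `p` carries `ω_S` and
`ω_R` to `S` and `R`, which turns a generator `Tr` of `Hom_R(ω_S, ω_R)` into a generator of
`Hom_R(S, R)`; the latter therefore differs from `T = Tr|_S` by `t` and `p`. -/
theorem pullback_canonicalDivisor_add_ramificationDivisor
    (hRS : Function.Injective (algebraMap R S)) {M : Submodule S L} (hM : M.FG)
    {N : Submodule R K} (hN : N.FG) (h1N : (1 : K) ∈ N) (h1M : (1 : L) ∈ M)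
    {Tr : M →ₗ[R] N} (hTr : IsGrothendieckTrace (S := S) Tr) {T : S →ₗ[R] R}
    (hT : ∀ s : S, (Tr (s • ⟨1, h1M⟩) : K) = algebraMap R K (T s)) :
    pullback S (canonicalDivisor N) + ramificationDivisor T = canonicalDivisor M := by
  funext Q
  obtain ⟨π, hπ⟩ := exists_ord_eq_one (below hRS Q)
  obtain ⟨b, z₀, p', q, t, c, hq, hz₀, hb, ht, hc⟩ := exists_pole Q hM h1M
  obtain ⟨a, w₀, w₁, w₂, p, c', hw₂, hw₀, ha, hp, hc'⟩ := exists_pole (below hRS Q) hN h1N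
  have hinjR := IsFractionRing.injective R K
  have hinjS := IsFractionRing.injective S L
  have hw₁ : w₁ ≠ 0 := by
    rintro rfl
    rw [(ord_eq_top_iff _).2 rfl, top_add, ord_eq_top_iff] at ha
    exact hw₂ ha
  have hp0 : p ≠ 0 := ne_zero_of_ord_eq_natCast hp
  have ht0 : t ≠ 0 := ne_zero_of_ord_eq_natCast ht
  have hw₁S : algebraMap R S w₁ ≠ 0 := (map_ne_zero_iff _ hRS).2 hw₁
  have hπS : algebraMap R S π ≠ 0 := (map_ne_zero_iff _ hRS).2 (ne_zero_of_ord_eq_one hπ)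
  obtain ⟨ε, hε⟩ : ∃ ε : ℕ, ord Q (algebraMap R S π) = ε :=
    ⟨_, (ENat.natCast_toNat (ord_ne_top Q hπS)).symm⟩
  have hpS : ord Q (algebraMap R S p) = (a * ε : ℕ) := by
    rw [ord_algebraMap hRS Q hπ hp0, hp, ENat.toNat_natCast, hε, nsmul_eq_mul, Nat.cast_mul]
  have hwS : ord Q (algebraMap R S w₂) = ord Q (algebraMap R S w₁) + (a * ε : ℕ) := by
    rw [ord_algebraMap hRS Q hπ hw₂, ord_algebraMap hRS Q hπ hw₁, ha, hε,
      ENat.toNat_add (ord_ne_top _ hw₁) (ENat.natCast_ne_top a), ENat.toNat_natCast, add_nsmul]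
    simp only [nsmul_eq_mul, Nat.cast_mul]
  -- every `h : S → R` is a fraction of `T`
  have hfrac (h : HomDual R S) : ∃ s : S,
      (algebraMap R S w₁ * t) • h = (algebraMap R S w₂ * s) • HomDual.of T := by
    obtain ⟨s, hs⟩ := hTr
      (LinearMap.toSpanSingleton R N w₀ ∘ₗ (h : S →ₗ[R] R) ∘ₗ c.restrictScalars R)
    refine ⟨s, LinearMap.ext fun u => ?_⟩
    have h1 : c (u • ⟨1, h1M⟩) = t * u := by
      apply hinjS
      rw [hc, map_mul]
      change t • u • (1 : L) = _
      rw [Algebra.smul_def, Algebra.smul_def, mul_one]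
    have h2 := congrArg (fun w : N => (w : K)) (hs (u • ⟨1, h1M⟩))
    change DFunLike.coe (F := S →ₗ[R] R) h (c (u • ⟨1, h1M⟩)) • (w₀ : K) =
      (Tr (s • u • ⟨1, h1M⟩) : K) at h2
    rw [h1, smul_smul, hT] at h2
    have h3 : w₂ • (w₀ : K) = algebraMap R K w₁ := by
      have := congrArg Subtype.val hw₀
      change w₂ • (w₀ : K) = w₁ • (1 : K) at this
      rw [this, Algebra.smul_def, mul_one]
    change DFunLike.coe (F := S →ₗ[R] R) h (algebraMap R S w₁ * t * u) =
      T (algebraMap R S w₂ * s * u)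
    rw [mul_assoc, mul_assoc, ← Algebra.smul_def, ← Algebra.smul_def, map_smul T]
    refine (LinearMap.map_smul h _ _).trans (hinjR ?_)
    rw [smul_eq_mul, smul_eq_mul, map_mul, map_mul, ← h2, ← h3, Algebra.smul_def, Algebra.smul_def]
    ring
  -- `Hom_R(S, R)` is nonzero and consists of fractions of `T`
  have hT0 : HomDual.of T ≠ 0 := by
    intro h0
    obtain ⟨h, hh⟩ := HomDual.exists_ne_zero hRS
    obtain ⟨s, hs⟩ := hfrac h
    rw [h0, smul_zero] at hs
    exact (HomDual.smul_eq_zero hs).elim (mul_ne_zero hw₁S ht0) hh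
  -- writing `T` itself as a fraction of `T` compares the orders of `t` and `p`
  obtain ⟨k, rfl⟩ : ∃ k : ℕ, b = a * ε + k := by
    obtain ⟨s, hs⟩ := hfrac (HomDual.of T)
    have h1 : algebraMap R S w₁ * t = algebraMap R S w₂ * s := by
      rw [← sub_eq_zero, ← sub_smul] at hs
      exact sub_eq_zero.1 ((HomDual.smul_eq_zero hs).resolve_right hT0)
    have h2 := congrArg (ord Q) h1
    rw [ord_mul, ord_mul, hwS, ht, add_assoc] at h2
    have h3 := ENat.add_right_injective_of_ne_top (ord_ne_top Q hw₁S) h2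
    refine ⟨b - a * ε, (Nat.add_sub_of_le ?_).symm⟩
    have h4 : ((a * ε : ℕ) : ℕ∞) ≤ b := le_self_add.trans_eq h3.symm
    exact_mod_cast h4
  have hram : lengthAt (HomDual R S ⧸ Submodule.span S {HomDual.of T}) Q.1 = k := by
    -- `u ↦ p Tr(u z₀)` is the element of `Hom_R(S, R)` with the largest pole relative to `T`
    let h₀ : HomDual R S := HomDual.of
      (c' ∘ₗ Tr ∘ₗ (LinearMap.toSpanSingleton S M z₀).restrictScalars R)
    refine lengthAt_quotient_eq Q (T := HomDual.of T) (h₀ := h₀) (q₀ := q)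
      (p₀ := algebraMap R S p * p') (fun s h e => HomDual.smul_eq_zero e) hT0
      (Submodule.mem_span_singleton_self _) ?_ hq ?_ ?_ ?_
    · intro h hh
      obtain ⟨s, rfl⟩ := Submodule.mem_span_singleton.1 hh
      exact ⟨1, (Ideal.ne_top_iff_one _).1 Q.1.isPrime.ne_top, s, one_smul _ _⟩
    · refine LinearMap.ext fun u => hinjR ?_
      change algebraMap R K (c' (Tr ((q * u) • z₀))) =
        algebraMap R K (T (algebraMap R S p * p' * u))
      rw [hc', mul_comm q, mul_smul, hz₀, smul_smul, hT, mul_assoc, ← Algebra.smul_def,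
        LinearMap.map_smul T, smul_eq_mul, map_mul (algebraMap R K), Algebra.smul_def, mul_comm u]
    · rw [hb, ord_mul, hpS, Nat.cast_add, add_comm (ord Q p'), add_right_comm]
    · intro h
      obtain ⟨s, hs⟩ := hfrac h
      refine ⟨_, _, mul_ne_zero hw₁S ht0, hs, ?_⟩
      rw [ord_mul, ord_mul, ht, hwS, Nat.cast_add, add_assoc, add_assoc]
      gcongr
      exact le_add_self
  rw [Pi.add_apply, pullback_apply hRS Q hπ, hε, ENat.toNat_natCast]
  simp only [canonicalDivisor, ramificationDivisor, cycle]
  rw [hram, lengthAt_of_pole Q hq hz₀ hb ht hc, lengthAt_of_pole _ hw₂ hw₀ ha hp hc']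
  push_cast
  ring

end Ramification

theorem pullback_add {R : Type*} [CommRing R] (S : Type*) [CommRing S] [Algebra R S]
    (D D' : PrimeDivisor R → ℚ) : pullback S (D + D') = pullback S D + pullback S D' := by
  funext Q
  simp only [pullback, Pi.add_apply]
  split_ifs
  · exact mul_add _ _ _
  · exact (add_zero 0).symm

end BCM

end

theorem mainTheorem10
    -- a finite extension `R ⊆ S` of complete normal local domains
    {R : Type uR} [CommRing R] [IsDomain R] [IsLocalRing R] [IsNoetherianRing R]
    [IsIntegrallyClosed R] [IsAdicComplete (IsLocalRing.maximalIdeal R) R]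
    {S : Type uS} [CommRing S] [IsDomain S] [IsLocalRing S] [IsNoetherianRing S]
    [IsIntegrallyClosed S] [IsAdicComplete (IsLocalRing.maximalIdeal S) S]
    [Algebra R S] [Module.Finite R S] (hRS : Function.Injective (algebraMap R S))
    -- `P = R⁺`, with a map `S → R⁺` of `R`-algebras, and a big Cohen-Macaulay `R⁺`-algebra `B`
    {P : Type*} [CommRing P] [Algebra R P] [Algebra S P] [IsScalarTower R S P]
    (hP : BCM.IsAbsoluteIntegralClosure R P)
    {B : Type*} [CommRing B] [Algebra P B] [Algebra R B] [Algebra S B]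
    [IsScalarTower R P B] [IsScalarTower S P B]
    (hB : BCM.IsBigCohenMacaulay R B)
    -- fraction fields
    {K : Type*} [Field K] [Algebra R K] [IsFractionRing R K]
    {L : Type*} [Field L] [Algebra S L] [IsFractionRing S L] [Algebra R L] [IsScalarTower R S L]
    -- systems of parameters (computing local cohomology) and injective hulls of the residue fields
    {d : ℕ} {x : Fin d → R} (hx : BCM.IsSystemOfParameters x)
    {e : ℕ} {y : Fin e → S} (hy : BCM.IsSystemOfParameters y)
    {E : Type uR} [AddCommGroup E] [Module R E] (hE : BCM.IsInjectiveHullOfResidueField R E)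
    {F : Type uS} [AddCommGroup F] [Module S F] (hF : BCM.IsInjectiveHullOfResidueField S F)
    -- canonical modules `ω_R ⊆ K`, `ω_S ⊆ L` and the Grothendieck trace
    (ωR : BCM.CanonicalIdeal K x E) (ωS : BCM.CanonicalIdeal L y F)
    (Tr : ωS.carrier →ₗ[R] ωR.carrier) (hTr : BCM.IsGrothendieckTrace (S := S) Tr) :
    (∀ Γ : BCM.PrimeDivisor R →₀ ℚ, 0 ≤ Γ → BCM.IsQCartier ⇑Γ →
      ((BCM.testSubmodule P B ωS (BCM.pullback S Γ)).restrictScalars R).map Tr =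
        BCM.testSubmodule P B ωR Γ) ∧
    (∀ (_h1R : (1 : K) ∈ ωR.carrier) (h1S : (1 : L) ∈ ωS.carrier)
      -- `T : S → R` is the restriction of `Tr` to `S ⊆ ω_S`
      (T : S →ₗ[R] R) (_hT : ∀ s : S, (Tr (s • ⟨1, h1S⟩) : K) = algebraMap R K (T s))
      (Δ : BCM.PrimeDivisor R →₀ ℚ), 0 ≤ Δ →
      BCM.IsQCartier (BCM.canonicalDivisor ωR.carrier + ⇑Δ) →
      BCM.ramificationDivisor T ≤ BCM.pullback S Δ →
      BCM.testIdeal P B ωR Δ =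
        ((BCM.testIdeal P B ωS (BCM.pullback S Δ - BCM.ramificationDivisor T)).restrictScalars
          R).map Tr) := by
  constructor
  · intro Γ hΓ0 hΓ
    exact BCM.map_testSubmodule_eq hRS hP hx hy hE hF ωR ωS Tr hTr (fun Q => hΓ0 Q) hΓ
  · intro h1R h1S T hT Δ hΔ0 hΔ _
    have hK := BCM.pullback_canonicalDivisor_add_ramificationDivisor hRS ωS.fg ωR.fg h1R h1S hTr hT
    -- `φ^*(K_R + Δ) = K_S + (φ^* Δ - Ram)`
    have hS : BCM.pullback S (BCM.canonicalDivisor ωR.carrier + ⇑Δ) =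
        BCM.canonicalDivisor ωS.carrier + (BCM.pullback S Δ - BCM.ramificationDivisor T) := by
      rw [BCM.pullback_add, ← hK]
      abel
    have h0 : 0 ≤ BCM.canonicalDivisor ωR.carrier + ⇑Δ :=
      fun Q => add_nonneg (Nat.cast_nonneg _) (hΔ0 Q)
    have key := BCM.map_testSubmodule_eq (B := B) hRS hP hx hy hE hF ωR ωS Tr hTr h0 hΔ
    rw [hS] at key
    exact key.symm
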